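/- Let $N\ge 128$ be an integer. For $x,y\in[-1,1]$ put $\rho(x,y)=|\arccos x-\arccos y|$. Let $X\subset\left[\cos\left(-\pi+\frac{2\pi}{N}\right),\cos\left(-\frac{2\pi}{N}\right)\right]$ be a set of points such that $\rho(x,x')\ge \frac{4\pi}{N}$ for all distinct $x,x'\in X$, and let $f=\sum_{x\in X}c_x\delta_x$ with $c_x\in\mathbb{C}$, a complex Borel measure on $[-1,1]$. Let $\mathcal{M}([-1,1])$ be the space of complex Borel measures on $[-1,1]$; for $g\in\mathcal{M}([-1,1])$ let $\|g\|_{TV}=|g|([-1,1])$ be its total variation norm, and write $\langle g,P\rangle=\int_{[-1,1]}P\,dg$ for a polynomial $P$. Let $\{P_k\}_{k=0}^{N}$ be any basis of the complex vector space of univariate algebraic polynomials of degree at most $N$, and let $y_k=\langle f,P_k\rangle$ for $0\le k\le N$. Then $f$ is the unique solution of $$\min_{g\in\mathcal{M}([-1,1])}\|g\|_{TV}\quad\text{subject to}\quad \langle g,P_k\rangle=y_k,\quad 0\le k\le N.$$ -/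

import Mathlib

open MeasureTheory

noncomputable section

namespace SplineRecovery

/-- The compact interval `[-1,1]`, with its Borel σ-algebra (as a subtype of `ℝ`). -/
abbrev I : Type := Set.Icc (-1 : ℝ) 1

/-- The metric `ρ(x,y) = |arccos x - arccos y|` on `[-1,1]`. -/
def rho (x y : I) : ℝ := |Real.arccos x - Real.arccos y|

/-- The minimal separation condition at level `N`: the points lie in
`[cos(-π+2π/N), cos(-2π/N)]`, and distinct points are at `ρ`-distance at least `4π/N`. -/
def MinimalSeparation (N : ℕ) (X : Set I) : Prop :=
  (∀ x ∈ X, (x : ℝ) ∈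
    Set.Icc (Real.cos (-Real.pi + 2 * Real.pi / N)) (Real.cos (-(2 * Real.pi / N)))) ∧
  ∀ x ∈ X, ∀ y ∈ X, x ≠ y → 4 * Real.pi / N ≤ rho x y

/-- `f = ∑_{x ∈ X} c_x δ_x`: on every Borel set the (unconditional) sum of the point masses
is the value of `f`. -/
def IsDiracSum (f : ComplexMeasure I) (X : Set I) (c : X → ℂ) : Prop :=
  ∀ E : Set I, MeasurableSet E →
    HasSum (fun x : X => VectorMeasure.dirac (x : I) (c x) E) (f E)

/-- The total variation norm `|v|([-1,1])` of a complex Borel measure. -/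
def tvNorm (v : ComplexMeasure I) : ENNReal := v.variation Set.univ

/-- The bilinear pairing `⟨v, P⟩ = ∫ P dv` of a complex Borel measure on `[-1,1]` with a
polynomial. -/
def pairing (v : ComplexMeasure I) (P : Polynomial ℂ) : ℂ :=
  v.integral (fun x : I => P.eval ((x : ℝ) : ℂ)) (ContinuousLinearMap.mul ℝ ℂ)

/-- The complex Borel measures `g` on `[-1,1]` with `⟨g, P_k⟩ = y_k` for every `k`. -/
def feasible {N : ℕ} (P : Fin (N + 1) → Polynomial ℂ) (y : Fin (N + 1) → ℂ) :
    Set (ComplexMeasure I) :=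
  {g | ∀ k, pairing g (P k) = y k}

end SplineRecovery

end

/-!
The optimality and uniqueness of `f` follow from a dual certificate: a polynomial `Q` of degree at
most `N` with `Q(x) = conj (c x) / |c x|` at the points `x ∈ X` (any unimodular value where
`c x = 0`) and `|Q| < 1` on `[-1, 1] \ X`. Every feasible `g` satisfies
`‖f‖_TV = ⟨f, Q⟩ = ⟨g, Q⟩ ≤ ∫ |Q| d|g| ≤ ‖g‖_TV`, so `f` is a minimizer. If `g` is another one, all
the inequalities are equalities, hence `|g|` is carried by the finite set `X`, and since `X` has at
most `N + 1` points, Lagrange polynomials recover the masses `g {x} = c x`.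

The certificate (`exists_dual_polynomial`) is built in the angle `θ = arccos x`. It suffices to find
a trigonometric polynomial of degree at most `N` which takes the prescribed values at the angles
`± arccos x`, `x ∈ X`, and has modulus less than one elsewhere: its even part is a polynomial in
`cos θ` (`exists_polynomial_eval_cos`). Put `m = ⌊N/2⌋ + 1` and rescale to `w = mθ/2`, so that the
nodes are `π`-separated modulo the period `mπ`. The trigonometric polynomial is sought in the form
`∑ (α_j K(w - p_j) + β_j K'(w - p_j))`, where `K(w) = (sin w / (m sin (w/m)))⁴` is the Jackson
kernel, of degree `2(m - 1) ≤ N` in `θ`, with the interpolation conditions that the values at the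
nodes are the given ones and the derivatives vanish there.

Two descriptions of `K` are used. It is an average of cosines `cos (b w)` (`jackson`) whose second
moment is `4/3 (1 - 1/m²)` and whose fourth moment is at most `24/5`; this gives the Taylor bounds
for `K` and `K'` near the origin. Away from `mπℤ` the closed form bounds `K` and its first three
derivatives by powers of the envelope `1 / (m |sin (w/m)|)`, and `tan s ≥ s` gives
`1 / (m sin (r/m))² ≤ 1/r² + 1/m²` for `0 < r ≤ mπ/2`. Summing over separated points
(`sum_envelope_le`) shows that the interpolation system is a small perturbation of a diagonal one
(`coeff_bounds`), so it is solvable with `α_j` close to the data and `β_j` small. The modulus is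
then estimated separately within `0.7` of a node (`norm_bumpSum_lt_one_near`, by a second-order
expansion of the contribution of the other nodes), at distance between `0.7` and `1.3`
(`norm_bumpSum_le_mid`), and at distance at least `1.3` from all of them
(`norm_bumpSum_lt_one_far`).
-/

namespace SplineRecovery

/-! ### Taylor bounds for averages of cosines -/

theorem cos_le_one_sub_sq_add_pow_four (x : ℝ) : Real.cos x ≤ 1 - x ^ 2 / 2 + x ^ 4 / 24 := by
  wlog hx : 0 ≤ x generalizing x
  · have := this (-x) (by linarith)
    rw [Real.cos_neg] at this
    nlinarith [this]
  have h1 : Real.cos x = 1 - 2 * Real.sin (x / 2) ^ 2 := by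
    have := Real.cos_two_mul' (x / 2)
    rw [show 2 * (x / 2) = x by ring] at this
    nlinarith [Real.sin_sq_add_cos_sq (x / 2)]
  have h2 := Real.sin_ge_sub_cube (x := x / 2) (by linarith)
  have h3 : (x / 2) ^ 2 - (x / 2) ^ 4 / 3 ≤ Real.sin (x / 2) ^ 2 := by
    rcases le_total 0 (x / 2 - (x / 2) ^ 3 / 6) with h | h
    · have := pow_le_pow_left₀ h h2 2
      nlinarith [sq_nonneg ((x / 2) ^ 3)]
    · have h4 : (x / 2) * (x / 2 - (x / 2) ^ 3 / 6) ≤ 0 :=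
        mul_nonpos_of_nonneg_of_nonpos (by linarith) h
      nlinarith [sq_nonneg (Real.sin (x / 2)), sq_nonneg (x / 2)]
  rw [h1]
  nlinarith

section CosineSums

variable {ι : Type*} [Fintype ι] (b : ι → ℝ) (u : ℝ)

theorem sum_one_sub_le_sum_cos :
    (Fintype.card ι : ℝ) - (∑ i, b i ^ 2) * u ^ 2 / 2 ≤ ∑ i, Real.cos (b i * u) := by
  have : ∀ i, 1 - (b i * u) ^ 2 / 2 ≤ Real.cos (b i * u) :=
    fun i => Real.one_sub_sq_div_two_le_cos
  calc _ = ∑ i, (1 - (b i * u) ^ 2 / 2) := by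
        simp only [Finset.sum_sub_distrib, Finset.sum_const, Finset.card_univ, nsmul_eq_mul,
          mul_one, mul_pow, ← Finset.sum_div, ← Finset.sum_mul]
    _ ≤ _ := Finset.sum_le_sum fun i _ => this i

theorem sum_cos_le :
    ∑ i, Real.cos (b i * u) ≤
      (Fintype.card ι : ℝ) - (∑ i, b i ^ 2) * u ^ 2 / 2 + (∑ i, b i ^ 4) * u ^ 4 / 24 := by
  calc _ ≤ ∑ i, (1 - (b i * u) ^ 2 / 2 + (b i * u) ^ 4 / 24) :=
        Finset.sum_le_sum fun i _ => cos_le_one_sub_sq_add_pow_four _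
    _ = _ := by
        simp only [Finset.sum_add_distrib, Finset.sum_sub_distrib, Finset.sum_const,
          Finset.card_univ, nsmul_eq_mul, mul_one, mul_pow, ← Finset.sum_div, ← Finset.sum_mul]

theorem abs_sum_mul_sin_le (hu : 0 ≤ u) :
    |∑ i, b i * Real.sin (b i * u)| ≤ (∑ i, b i ^ 2) * u := by
  refine (Finset.abs_sum_le_sum_abs _ _).trans ?_
  rw [Finset.sum_mul]
  refine Finset.sum_le_sum fun i _ => ?_
  rw [abs_mul]
  calc |b i| * |Real.sin (b i * u)| ≤ |b i| * |b i * u| :=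
        mul_le_mul_of_nonneg_left Real.abs_sin_le_abs (abs_nonneg _)
    _ = b i ^ 2 * u := by rw [abs_mul, abs_of_nonneg hu, ← mul_assoc, ← sq, sq_abs]

theorem abs_sum_mul_sin_sub_le (hu : 0 ≤ u) :
    |∑ i, b i * Real.sin (b i * u) - (∑ i, b i ^ 2) * u| ≤ (∑ i, b i ^ 4) * u ^ 3 / 6 := by
  rw [Finset.sum_mul, ← Finset.sum_sub_distrib, Finset.sum_mul, Finset.sum_div]
  refine (Finset.abs_sum_le_sum_abs _ _).trans (Finset.sum_le_sum fun i _ => ?_)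
  have key : ∀ x : ℝ, |Real.sin x - x| ≤ |x| ^ 3 / 6 := by
    intro x
    wlog hx : 0 ≤ x generalizing x
    · have := this (-x) (by linarith)
      rw [Real.sin_neg, abs_neg, show -Real.sin x - -x = -(Real.sin x - x) by ring, abs_neg] at this
      exact this
    rw [abs_of_nonneg hx, abs_le]
    constructor
    · linarith [Real.sin_ge_sub_cube hx]
    · have := Real.sin_le hx
      have : 0 ≤ x ^ 3 := by positivity
      linarith
  calc |b i * Real.sin (b i * u) - b i ^ 2 * u|
      = |b i| * |Real.sin (b i * u) - b i * u| := by rw [← abs_mul]; congr 1; ring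
    _ ≤ |b i| * (|b i * u| ^ 3 / 6) := by gcongr; exact key _
    _ = |b i| ^ 4 * u ^ 3 / 6 := by rw [abs_mul, abs_of_nonneg hu]; ring
    _ = b i ^ 4 * u ^ 3 / 6 := by rw [Even.pow_abs (by decide)]

end CosineSums

/-! ### Moments of the frequencies of the Jackson kernel -/

section Moments

variable {ι κ : Type*} [Fintype ι] [Fintype κ] (a : ι → ℝ) (b : κ → ℝ)

theorem sum_prod_add :
    ∑ p : ι × κ, (a p.1 + b p.2) = Fintype.card κ * ∑ i, a i + Fintype.card ι * ∑ j, b j := by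
  simp only [Fintype.sum_prod_type, Finset.sum_add_distrib, Finset.sum_const, Finset.card_univ,
    nsmul_eq_mul, Finset.mul_sum]

theorem sum_prod_add_sq (ha : ∑ i, a i = 0) :
    ∑ p : ι × κ, (a p.1 + b p.2) ^ 2 =
      Fintype.card κ * ∑ i, a i ^ 2 + Fintype.card ι * ∑ j, b j ^ 2 := by
  have : ∀ p : ι × κ, (a p.1 + b p.2) ^ 2 = a p.1 ^ 2 + 2 * (a p.1 * b p.2) + b p.2 ^ 2 :=
    fun p => by ring
  simp only [this, Fintype.sum_prod_type, Finset.sum_add_distrib, Finset.sum_const,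
    Finset.card_univ, nsmul_eq_mul, ← Finset.mul_sum, ← Finset.sum_mul, ha]
  ring

theorem sum_prod_add_pow_four (ha : ∑ i, a i = 0) (hb : ∑ j, b j = 0) :
    ∑ p : ι × κ, (a p.1 + b p.2) ^ 4 =
      Fintype.card κ * ∑ i, a i ^ 4 + 6 * (∑ i, a i ^ 2) * (∑ j, b j ^ 2) +
        Fintype.card ι * ∑ j, b j ^ 4 := by
  have : ∀ p : ι × κ, (a p.1 + b p.2) ^ 4 = a p.1 ^ 4 + 4 * (a p.1 ^ 3 * b p.2) +
      6 * (a p.1 ^ 2 * b p.2 ^ 2) + 4 * (a p.1 * b p.2 ^ 3) + b p.2 ^ 4 := fun p => by ring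
  simp only [this, Fintype.sum_prod_type, Finset.sum_add_distrib, Finset.sum_const,
    Finset.card_univ, nsmul_eq_mul, ← Finset.mul_sum, ← Finset.sum_mul, ha, hb]
  ring

end Moments

/-- The frequencies `(m - 1 - 2k)/m`, `0 ≤ k < m`, of the Dirichlet kernel
`sin w / (m sin (w/m))`. -/
noncomputable def dirichletFreq (m : ℕ) (k : Fin m) : ℝ := ((m : ℝ) - 1 - 2 * (k : ℕ)) / m

theorem sum_dirichletFreq (m : ℕ) : ∑ k, dirichletFreq m k = 0 := by
  have h : ∀ (c : ℝ) (n : ℕ), ∑ k ∈ Finset.range n, (c - 2 * (k : ℝ)) = n * (c - (n - 1)) := by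
    intro c n
    induction n with
    | zero => simp
    | succ n ih => rw [Finset.sum_range_succ, ih]; push_cast; ring
  simp only [dirichletFreq, ← Finset.sum_div]
  rw [Fin.sum_univ_eq_sum_range (fun k : ℕ => (m : ℝ) - 1 - 2 * (k : ℝ)), h]
  simp

theorem sum_dirichletFreq_sq (m : ℕ) (hm : 0 < m) :
    ∑ k, dirichletFreq m k ^ 2 = ((m : ℝ) ^ 2 - 1) / (3 * m) := by
  have h : ∀ (c : ℝ) (n : ℕ), ∑ k ∈ Finset.range n, (c - 2 * (k : ℝ)) ^ 2 =
      n * c ^ 2 - 2 * c * n * (n - 1) + 2 / 3 * (n * (n - 1) * (2 * n - 1)) := by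
    intro c n
    induction n with
    | zero => simp
    | succ n ih => rw [Finset.sum_range_succ, ih]; push_cast; ring
  have hm' : (m : ℝ) ≠ 0 := by positivity
  simp only [dirichletFreq, div_pow, ← Finset.sum_div]
  rw [Fin.sum_univ_eq_sum_range (fun k : ℕ => ((m : ℝ) - 1 - 2 * (k : ℝ)) ^ 2), h]
  field_simp
  ring

theorem sum_dirichletFreq_pow_four (m : ℕ) (hm : 0 < m) :
    ∑ k, dirichletFreq m k ^ 4 = ((m : ℝ) ^ 2 - 1) * (3 * m ^ 2 - 7) / (15 * m ^ 3) := by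
  have h : ∀ (c : ℝ) (n : ℕ), ∑ k ∈ Finset.range n, (c - 2 * (k : ℝ)) ^ 4 =
      n * c ^ 4 - 4 * c ^ 3 * (n * (n - 1)) + 4 * c ^ 2 * (n * (n - 1) * (2 * n - 1))
        - 8 * c * (n * (n - 1)) ^ 2
        + 8 / 15 * (n * (n - 1) * (2 * n - 1) * (3 * n ^ 2 - 3 * n - 1)) := by
    intro c n
    induction n with
    | zero => simp
    | succ n ih => rw [Finset.sum_range_succ, ih]; push_cast; ring
  have hm' : (m : ℝ) ≠ 0 := by positivity
  simp only [dirichletFreq, div_pow, ← Finset.sum_div]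
  rw [Fin.sum_univ_eq_sum_range (fun k : ℕ => ((m : ℝ) - 1 - 2 * (k : ℝ)) ^ 4), h]
  field_simp
  ring

/-- The index set of the frequencies of the fourth power of the Dirichlet kernel. -/
abbrev JacksonIdx (m : ℕ) : Type := (Fin m × Fin m) × (Fin m × Fin m)

/-- The integer frequencies of the Jackson kernel in the variable `θ = 2w/m`. -/
def jacksonIntFreq (m : ℕ) (p : JacksonIdx m) : ℤ :=
  2 * ((m : ℤ) - 1) - ((p.1.1 : ℕ) + (p.1.2 : ℕ) + (p.2.1 : ℕ) + (p.2.2 : ℕ))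

/-- The frequencies of the Jackson kernel in the variable `w`: sums of four Dirichlet
frequencies. -/
noncomputable def jacksonFreq (m : ℕ) (p : JacksonIdx m) : ℝ :=
  (dirichletFreq m p.1.1 + dirichletFreq m p.1.2) + (dirichletFreq m p.2.1 + dirichletFreq m p.2.2)

theorem jacksonFreq_eq (m : ℕ) (p : JacksonIdx m) :
    jacksonFreq m p = 2 * (jacksonIntFreq m p : ℝ) / m := by
  simp only [jacksonFreq, dirichletFreq, jacksonIntFreq]
  push_cast
  ring

theorem natAbs_jacksonIntFreq_le (m : ℕ) (p : JacksonIdx m) :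
    (jacksonIntFreq m p).natAbs ≤ 2 * (m - 1) := by
  have h1 := p.1.1.isLt
  have h2 := p.1.2.isLt
  have h3 := p.2.1.isLt
  have h4 := p.2.2.isLt
  simp only [jacksonIntFreq]
  omega

theorem card_jacksonIdx (m : ℕ) : (Fintype.card (JacksonIdx m) : ℝ) = m ^ 4 := by
  simp only [Fintype.card_prod, Fintype.card_fin]
  push_cast
  ring

theorem sum_jacksonFreq_sq (m : ℕ) (hm : 0 < m) :
    ∑ p, jacksonFreq m p ^ 2 = 4 / 3 * (1 - 1 / (m : ℝ) ^ 2) * m ^ 4 := by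
  have hm' : (m : ℝ) ≠ 0 := by positivity
  have h0 := sum_dirichletFreq m
  have h1 := sum_prod_add (dirichletFreq m) (dirichletFreq m)
  rw [h0, mul_zero, add_zero] at h1
  have h2 := sum_prod_add_sq (dirichletFreq m) (dirichletFreq m) h0
  have h3 := sum_prod_add_sq (fun p : Fin m × Fin m => dirichletFreq m p.1 + dirichletFreq m p.2)
    (fun p : Fin m × Fin m => dirichletFreq m p.1 + dirichletFreq m p.2) h1
  simp only [jacksonFreq]
  rw [h3, h2, sum_dirichletFreq_sq m hm]
  simp only [Fintype.card_prod, Fintype.card_fin]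
  push_cast
  field_simp
  ring

theorem sum_jacksonFreq_pow_four_le (m : ℕ) (hm : 0 < m) :
    ∑ p, jacksonFreq m p ^ 4 ≤ 24 / 5 * (m : ℝ) ^ 4 := by
  have hm' : (m : ℝ) ≠ 0 := by positivity
  have hm1 : (1 : ℝ) ≤ m := by exact_mod_cast hm
  have h0 := sum_dirichletFreq m
  have h1 := sum_prod_add (dirichletFreq m) (dirichletFreq m)
  rw [h0, mul_zero, add_zero] at h1
  have h2 := sum_prod_add_sq (dirichletFreq m) (dirichletFreq m) h0
  have h4 := sum_prod_add_pow_four (dirichletFreq m) (dirichletFreq m) h0 h0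
  have h3 := sum_prod_add_pow_four
    (fun p : Fin m × Fin m => dirichletFreq m p.1 + dirichletFreq m p.2)
    (fun p : Fin m × Fin m => dirichletFreq m p.1 + dirichletFreq m p.2) h1 h1
  simp only [jacksonFreq]
  rw [h3, h2, h4, sum_dirichletFreq_sq m hm, sum_dirichletFreq_pow_four m hm]
  simp only [Fintype.card_prod, Fintype.card_fin]
  push_cast
  have : (m : ℝ) * m * (m * ((m ^ 2 - 1) * (3 * m ^ 2 - 7) / (15 * m ^ 3)) +
      6 * ((m ^ 2 - 1) / (3 * m)) * ((m ^ 2 - 1) / (3 * m)) +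
      m * ((m ^ 2 - 1) * (3 * m ^ 2 - 7) / (15 * m ^ 3))) +
      6 * (m * ((m ^ 2 - 1) / (3 * m)) + m * ((m ^ 2 - 1) / (3 * m))) *
        (m * ((m ^ 2 - 1) / (3 * m)) + m * ((m ^ 2 - 1) / (3 * m))) +
      m * m * (m * ((m ^ 2 - 1) * (3 * m ^ 2 - 7) / (15 * m ^ 3)) +
      6 * ((m ^ 2 - 1) / (3 * m)) * ((m ^ 2 - 1) / (3 * m)) +
      m * ((m ^ 2 - 1) * (3 * m ^ 2 - 7) / (15 * m ^ 3))) =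
      4 / 15 * ((m ^ 2 - 1) * (3 * m ^ 2 - 7)) + 4 * ((m : ℝ) ^ 2 - 1) ^ 2 := by
    field_simp
    ring
  rw [this]
  nlinarith [sq_nonneg ((m : ℝ) ^ 2)]

/-! ### The Jackson kernel and its derivatives -/

/-- The Jackson kernel `(sin w / (m sin (w/m)))^4`, written as an average of cosines. -/
noncomputable def jackson (m : ℕ) (w : ℝ) : ℝ := (∑ p, Real.cos (jacksonFreq m p * w)) / m ^ 4

/-- The first derivative of the Jackson kernel. -/
noncomputable def jackson' (m : ℕ) (w : ℝ) : ℝ :=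
  -(∑ p, jacksonFreq m p * Real.sin (jacksonFreq m p * w)) / m ^ 4

/-- The second derivative of the Jackson kernel. -/
noncomputable def jackson'' (m : ℕ) (w : ℝ) : ℝ :=
  -(∑ p, jacksonFreq m p ^ 2 * Real.cos (jacksonFreq m p * w)) / m ^ 4

/-- The third derivative of the Jackson kernel. -/
noncomputable def jackson''' (m : ℕ) (w : ℝ) : ℝ :=
  (∑ p, jacksonFreq m p ^ 3 * Real.sin (jacksonFreq m p * w)) / m ^ 4

theorem hasDerivAt_jackson (m : ℕ) (w : ℝ) : HasDerivAt (jackson m) (jackson' m w) w := by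
  have : ∀ p ∈ (Finset.univ : Finset (JacksonIdx m)),
      HasDerivAt (fun w => Real.cos (jacksonFreq m p * w))
        (-(jacksonFreq m p * Real.sin (jacksonFreq m p * w))) w := fun p _ => by
    refine ((hasDerivAt_id w).const_mul (jacksonFreq m p)).cos.congr_deriv ?_
    simp only [id]
    ring
  have h := (HasDerivAt.fun_sum this).div_const ((m : ℝ) ^ 4)
  rw [Finset.sum_neg_distrib] at h
  exact h

theorem hasDerivAt_jackson' (m : ℕ) (w : ℝ) : HasDerivAt (jackson' m) (jackson'' m w) w := by
  have : ∀ p ∈ (Finset.univ : Finset (JacksonIdx m)),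
      HasDerivAt (fun w => jacksonFreq m p * Real.sin (jacksonFreq m p * w))
        (jacksonFreq m p ^ 2 * Real.cos (jacksonFreq m p * w)) w := fun p _ => by
    refine ((((hasDerivAt_id w).const_mul (jacksonFreq m p)).sin).const_mul
      (jacksonFreq m p)).congr_deriv ?_
    simp only [id]
    ring
  exact ((HasDerivAt.fun_sum this).neg).div_const ((m : ℝ) ^ 4)

theorem hasDerivAt_jackson'' (m : ℕ) (w : ℝ) : HasDerivAt (jackson'' m) (jackson''' m w) w := by
  have : ∀ p ∈ (Finset.univ : Finset (JacksonIdx m)),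
      HasDerivAt (fun w => jacksonFreq m p ^ 2 * Real.cos (jacksonFreq m p * w))
        (-(jacksonFreq m p ^ 3 * Real.sin (jacksonFreq m p * w))) w := fun p _ => by
    refine ((((hasDerivAt_id w).const_mul (jacksonFreq m p)).cos).const_mul
      (jacksonFreq m p ^ 2)).congr_deriv ?_
    simp only [id]
    ring
  have h := ((HasDerivAt.fun_sum this).neg).div_const ((m : ℝ) ^ 4)
  rw [Finset.sum_neg_distrib, neg_neg] at h
  exact h

theorem jacksonFreq_mul_sub_period {m : ℕ} (hm : 0 < m) (p : JacksonIdx m) (w : ℝ) (n : ℤ) :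
    jacksonFreq m p * (w - n * (m * Real.pi)) =
      jacksonFreq m p * w - ((jacksonIntFreq m p * n : ℤ) : ℝ) * (2 * Real.pi) := by
  have hm' : (m : ℝ) ≠ 0 := by positivity
  rw [jacksonFreq_eq]
  push_cast
  field_simp

theorem jackson_sub_period {m : ℕ} (hm : 0 < m) (w : ℝ) (n : ℤ) :
    jackson m (w - n * (m * Real.pi)) = jackson m w := by
  simp only [jackson, jacksonFreq_mul_sub_period hm, Real.cos_sub_int_mul_two_pi]

theorem jackson'_sub_period {m : ℕ} (hm : 0 < m) (w : ℝ) (n : ℤ) :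
    jackson' m (w - n * (m * Real.pi)) = jackson' m w := by
  simp only [jackson', jacksonFreq_mul_sub_period hm, Real.sin_sub_int_mul_two_pi]

theorem jackson_zero {m : ℕ} (hm : 0 < m) : jackson m 0 = 1 := by
  have hm' : (m : ℝ) ≠ 0 := by positivity
  have := card_jacksonIdx m
  simp only [jackson, mul_zero, Real.cos_zero, Finset.sum_const, Finset.card_univ, nsmul_eq_mul,
    mul_one, this]
  field_simp

theorem jackson'_zero (m : ℕ) : jackson' m 0 = 0 := by
  simp [jackson']

theorem jackson''_zero {m : ℕ} (hm : 0 < m) :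
    jackson'' m 0 = -(4 / 3 * (1 - 1 / (m : ℝ) ^ 2)) := by
  have hm' : (m : ℝ) ≠ 0 := by positivity
  simp only [jackson'', mul_zero, Real.cos_zero, mul_one, sum_jacksonFreq_sq m hm]
  field_simp

theorem one_sub_le_jackson {m : ℕ} (hm : 0 < m) (u : ℝ) :
    1 - 2 / 3 * u ^ 2 ≤ jackson m u := by
  have hm' : (0 : ℝ) < (m : ℝ) ^ 4 := by positivity
  rw [jackson, le_div_iff₀ hm']
  refine le_trans ?_ (sum_one_sub_le_sum_cos _ u)
  rw [card_jacksonIdx, sum_jacksonFreq_sq m hm]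
  have h1 : 0 ≤ 1 / (m : ℝ) ^ 2 := by positivity
  have : 0 ≤ 1 / (m : ℝ) ^ 2 * (m ^ 4 * u ^ 2) := by positivity
  nlinarith

theorem jackson_le {m : ℕ} (hm : 65 ≤ m) (u : ℝ) :
    jackson m u ≤ 1 - 0.6665 * u ^ 2 + 0.2 * u ^ 4 := by
  have hm0 : 0 < m := by omega
  have hm' : (0 : ℝ) < (m : ℝ) ^ 4 := by positivity
  rw [jackson, div_le_iff₀ hm']
  refine (sum_cos_le _ u).trans ?_
  rw [card_jacksonIdx, sum_jacksonFreq_sq m hm0]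
  have h1 : 1 / (m : ℝ) ^ 2 ≤ 1 / 65 ^ 2 := by
    gcongr; exact_mod_cast hm
  have h2 : 1 / (m : ℝ) ^ 2 * (m ^ 4 * u ^ 2) ≤ 1 / 65 ^ 2 * (m ^ 4 * u ^ 2) := by gcongr
  have h3 : (∑ p, jacksonFreq m p ^ 4) * u ^ 4 ≤ 24 / 5 * (m : ℝ) ^ 4 * u ^ 4 := by
    gcongr
    exact sum_jacksonFreq_pow_four_le m hm0
  have h4 : 0 ≤ (m : ℝ) ^ 4 * u ^ 2 := by positivity
  nlinarith

theorem abs_jackson'_le {m : ℕ} (hm : 0 < m) {u : ℝ} (hu : 0 ≤ u) :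
    |jackson' m u| ≤ 4 / 3 * u := by
  have hm' : (0 : ℝ) < (m : ℝ) ^ 4 := by positivity
  rw [jackson', abs_div, abs_neg, abs_of_pos hm', div_le_iff₀ hm']
  refine (abs_sum_mul_sin_le _ u hu).trans ?_
  rw [sum_jacksonFreq_sq m hm]
  have : 0 ≤ 1 / (m : ℝ) ^ 2 * (m ^ 4 * u) := by positivity
  nlinarith

theorem abs_jackson'_sub_le {m : ℕ} (hm : 0 < m) {u : ℝ} (hu : 0 ≤ u) :
    |jackson' m u - jackson'' m 0 * u| ≤ 0.8 * u ^ 3 := by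
  have hm' : (0 : ℝ) < (m : ℝ) ^ 4 := by positivity
  have h := abs_sum_mul_sin_sub_le (jacksonFreq m) u hu
  rw [sum_jacksonFreq_sq m hm] at h
  have : jackson' m u - jackson'' m 0 * u =
      -(∑ p, jacksonFreq m p * Real.sin (jacksonFreq m p * u) -
        4 / 3 * (1 - 1 / (m : ℝ) ^ 2) * m ^ 4 * u) / m ^ 4 := by
    rw [jackson''_zero hm, jackson']
    generalize ∑ p, jacksonFreq m p * Real.sin (jacksonFreq m p * u) = s
    field_simp
    ring
  rw [this, abs_div, abs_neg, abs_of_pos hm', div_le_iff₀ hm']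
  refine h.trans ?_
  have h3 : (∑ p, jacksonFreq m p ^ 4) * u ^ 3 ≤ 24 / 5 * (m : ℝ) ^ 4 * u ^ 3 := by
    gcongr
    exact sum_jacksonFreq_pow_four_le m hm
  nlinarith

/-! ### Closed form of the Jackson kernel away from its poles -/

section AngleSums

variable {ι κ : Type*} [Fintype ι] [Fintype κ] (a : ι → ℝ) (b : κ → ℝ)

theorem sum_prod_cos_add :
    ∑ p : ι × κ, Real.cos (a p.1 + b p.2) =
      (∑ i, Real.cos (a i)) * (∑ j, Real.cos (b j)) -
        (∑ i, Real.sin (a i)) * (∑ j, Real.sin (b j)) := by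
  simp only [Fintype.sum_prod_type, Real.cos_add, Finset.sum_sub_distrib, Finset.sum_mul_sum]

theorem sum_prod_sin_add :
    ∑ p : ι × κ, Real.sin (a p.1 + b p.2) =
      (∑ i, Real.sin (a i)) * (∑ j, Real.cos (b j)) +
        (∑ i, Real.cos (a i)) * (∑ j, Real.sin (b j)) := by
  simp only [Fintype.sum_prod_type, Real.sin_add, Finset.sum_add_distrib, Finset.sum_mul_sum]

end AngleSums

/-- The Dirichlet kernel in closed form, multiplied out; the sum telescopes. -/
theorem sum_cos_dirichletFreq_mul_sin {m : ℕ} (hm : 0 < m) (w : ℝ) :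
    (∑ k, Real.cos (dirichletFreq m k * w)) * Real.sin (w / m) = Real.sin w := by
  have hm' : (m : ℝ) ≠ 0 := by positivity
  have h : ∀ k : ℕ, Real.cos (((m : ℝ) - 1 - 2 * k) / m * w) * Real.sin (w / m) =
      Real.sin (((m : ℝ) - 2 * k) / m * w) / 2 -
        Real.sin (((m : ℝ) - 2 * (k + 1 : ℕ)) / m * w) / 2 := by
    intro k
    rw [show ((m : ℝ) - 2 * k) / m * w = ((m : ℝ) - 1 - 2 * k) / m * w + w / m by ring,
      show ((m : ℝ) - 2 * (k + 1 : ℕ)) / m * w = ((m : ℝ) - 1 - 2 * k) / m * w - w / m by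
        push_cast; ring, Real.sin_add, Real.sin_sub]
    ring
  simp only [dirichletFreq, Finset.sum_mul, h]
  rw [Fin.sum_univ_eq_sum_range (fun k : ℕ => Real.sin (((m : ℝ) - 2 * k) / m * w) / 2 -
        Real.sin (((m : ℝ) - 2 * (k + 1 : ℕ)) / m * w) / 2), Finset.sum_range_sub']
  rw [show ((m : ℝ) - 2 * (0 : ℕ)) / m * w = w by push_cast; field_simp; ring,
    show ((m : ℝ) - 2 * m) / m * w = -w by field_simp; ring, Real.sin_neg]
  ring

theorem sum_sin_dirichletFreq_mul_sin {m : ℕ} (hm : 0 < m) (w : ℝ) :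
    (∑ k, Real.sin (dirichletFreq m k * w)) * Real.sin (w / m) = 0 := by
  have hm' : (m : ℝ) ≠ 0 := by positivity
  have h : ∀ k : ℕ, Real.sin (((m : ℝ) - 1 - 2 * k) / m * w) * Real.sin (w / m) =
      -Real.cos (((m : ℝ) - 2 * k) / m * w) / 2 -
        -Real.cos (((m : ℝ) - 2 * (k + 1 : ℕ)) / m * w) / 2 := by
    intro k
    rw [show ((m : ℝ) - 2 * k) / m * w = ((m : ℝ) - 1 - 2 * k) / m * w + w / m by ring,
      show ((m : ℝ) - 2 * (k + 1 : ℕ)) / m * w = ((m : ℝ) - 1 - 2 * k) / m * w - w / m by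
        push_cast; ring, Real.cos_add, Real.cos_sub]
    ring
  simp only [dirichletFreq, Finset.sum_mul, h]
  rw [Fin.sum_univ_eq_sum_range (fun k : ℕ => -Real.cos (((m : ℝ) - 2 * k) / m * w) / 2 -
        -Real.cos (((m : ℝ) - 2 * (k + 1 : ℕ)) / m * w) / 2), Finset.sum_range_sub']
  rw [show ((m : ℝ) - 2 * (0 : ℕ)) / m * w = w by push_cast; field_simp; ring,
    show ((m : ℝ) - 2 * m) / m * w = -w by field_simp; ring, Real.cos_neg]
  ring

/-- The envelope `1 / (m sin (w/m))` of the Dirichlet kernel. -/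
noncomputable def envelope (m : ℕ) (w : ℝ) : ℝ := (m * Real.sin (w / m))⁻¹

theorem jackson_eq {m : ℕ} (hm : 0 < m) {w : ℝ} (hw : Real.sin (w / m) ≠ 0) :
    jackson m w = Real.sin w ^ 4 * envelope m w ^ 4 := by
  have hm' : (m : ℝ) ≠ 0 := by positivity
  have hc := sum_cos_dirichletFreq_mul_sin hm w
  have hs : ∑ k, Real.sin (dirichletFreq m k * w) = 0 :=
    (mul_eq_zero.1 (sum_sin_dirichletFreq_mul_sin hm w)).resolve_right hw
  simp only [jackson, jacksonFreq, add_mul]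
  rw [sum_prod_cos_add (fun p : Fin m × Fin m => dirichletFreq m p.1 * w + dirichletFreq m p.2 * w)
    (fun p : Fin m × Fin m => dirichletFreq m p.1 * w + dirichletFreq m p.2 * w),
    sum_prod_cos_add (fun k => dirichletFreq m k * w) (fun k => dirichletFreq m k * w),
    sum_prod_sin_add (fun k => dirichletFreq m k * w) (fun k => dirichletFreq m k * w), hs,
    ← hc, envelope]
  generalize ∑ k, Real.cos (dirichletFreq m k * w) = c
  field_simp
  ring

theorem envelope_ne_zero {m : ℕ} (hm : 0 < m) {w : ℝ} (hw : Real.sin (w / m) ≠ 0) :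
    envelope m w ≠ 0 := by
  have hm' : (m : ℝ) ≠ 0 := by positivity
  exact inv_ne_zero (mul_ne_zero hm' hw)

theorem hasDerivAt_envelope {m : ℕ} (hm : 0 < m) {w : ℝ} (hw : Real.sin (w / m) ≠ 0) :
    HasDerivAt (envelope m) (-Real.cos (w / m) * envelope m w ^ 2) w := by
  have hm' : (m : ℝ) ≠ 0 := by positivity
  have h1 : HasDerivAt (fun w : ℝ => (m : ℝ) * Real.sin (w / m)) (Real.cos (w / m)) w := by
    refine ((((hasDerivAt_id w).div_const (m : ℝ)).sin).const_mul (m : ℝ)).congr_deriv ?_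
    simp only [id]
    field_simp
  refine (h1.fun_inv (mul_ne_zero hm' hw)).congr_deriv ?_
  rw [envelope]
  field_simp

theorem hasDerivAt_cos_div {m : ℕ} (hm : 0 < m) {w : ℝ} (hw : Real.sin (w / m) ≠ 0) :
    HasDerivAt (fun w : ℝ => Real.cos (w / m)) (-1 / (m ^ 2 * envelope m w)) w := by
  have hm' : (m : ℝ) ≠ 0 := by positivity
  refine (((hasDerivAt_id w).div_const (m : ℝ)).cos).congr_deriv ?_
  rw [envelope]
  simp only [id]
  field_simp

theorem eventually_sin_div_ne_zero (m : ℕ) {w : ℝ} (hw : Real.sin (w / m) ≠ 0) :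
    ∀ᶠ x in nhds w, Real.sin (x / m) ≠ 0 :=
  (by fun_prop : ContinuousAt (fun x : ℝ => Real.sin (x / m)) w).eventually_ne hw

theorem cos_div_sq {m : ℕ} (hm : 0 < m) (w : ℝ) :
    Real.cos (w / m) ^ 2 = 1 - 1 / (m ^ 2 * envelope m w ^ 2) := by
  have hm' : (m : ℝ) ≠ 0 := by positivity
  rw [Real.cos_sq', envelope]
  field_simp

theorem jackson'_eq {m : ℕ} (hm : 0 < m) {w : ℝ} (hw : Real.sin (w / m) ≠ 0) :
    jackson' m w = (4 * Real.sin w ^ 3 * Real.cos w) * envelope m w ^ 4 +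
      Real.sin w ^ 4 * (-4 * Real.cos (w / m) * envelope m w ^ 5) := by
  refine (hasDerivAt_jackson m w).unique ?_
  have h := ((Real.hasDerivAt_sin w).fun_pow 4).fun_mul ((hasDerivAt_envelope hm hw).fun_pow 4)
  refine (h.congr_deriv ?_).congr_of_eventuallyEq ?_
  · simp only [Nat.cast_ofNat, Nat.add_one_sub_one]
    ring
  · filter_upwards [eventually_sin_div_ne_zero m hw] with x hx
    exact jackson_eq hm hx

theorem jackson''_eq {m : ℕ} (hm : 0 < m) {w : ℝ} (hw : Real.sin (w / m) ≠ 0) :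
    jackson'' m w =
      (12 * Real.sin w ^ 2 * Real.cos w ^ 2 - 4 * Real.sin w ^ 4) * envelope m w ^ 4 +
      2 * (4 * Real.sin w ^ 3 * Real.cos w) * (-4 * Real.cos (w / m) * envelope m w ^ 5) +
      Real.sin w ^ 4 * (20 * envelope m w ^ 6 - 16 * envelope m w ^ 4 / m ^ 2) := by
  refine (hasDerivAt_jackson' m w).unique ?_
  have hF := hasDerivAt_envelope hm hw
  have hF0 := envelope_ne_zero hm hw
  have hm' : (m : ℝ) ≠ 0 := by positivity
  have h := ((((Real.hasDerivAt_sin w).fun_pow 3).const_mul 4).fun_mul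
    (Real.hasDerivAt_cos w)).fun_mul (hF.fun_pow 4)
  have h' := ((Real.hasDerivAt_sin w).fun_pow 4).fun_mul
    (((hasDerivAt_cos_div hm hw).const_mul (-4)).fun_mul (hF.fun_pow 5))
  refine ((h.fun_add h').congr_deriv ?_).congr_of_eventuallyEq ?_
  · have hc := cos_div_sq hm w
    generalize envelope m w = F at *
    generalize Real.cos (w / m) = c at *
    generalize Real.sin w = s at *
    generalize Real.cos w = k at *
    simp only [Nat.cast_ofNat, Nat.add_one_sub_one]
    have e : -4 * (-1 / ((m : ℝ) ^ 2 * F)) * F ^ 5 + -4 * c * (5 * F ^ 4 * (-c * F ^ 2)) =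
        20 * F ^ 6 - 16 * F ^ 4 / m ^ 2 := by
      rw [show -4 * c * (5 * F ^ 4 * (-c * F ^ 2)) = 20 * c ^ 2 * F ^ 6 by ring, hc]
      field_simp
      ring
    rw [e]
    ring
  · filter_upwards [eventually_sin_div_ne_zero m hw] with x hx
    exact jackson'_eq hm hx

theorem jackson'''_eq {m : ℕ} (hm : 0 < m) {w : ℝ} (hw : Real.sin (w / m) ≠ 0) :
    jackson''' m w =
      (24 * Real.sin w * Real.cos w ^ 3 - 40 * Real.sin w ^ 3 * Real.cos w) * envelope m w ^ 4 +
      3 * (12 * Real.sin w ^ 2 * Real.cos w ^ 2 - 4 * Real.sin w ^ 4) *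
        (-4 * Real.cos (w / m) * envelope m w ^ 5) +
      3 * (4 * Real.sin w ^ 3 * Real.cos w) *
        (20 * envelope m w ^ 6 - 16 * envelope m w ^ 4 / m ^ 2) +
      Real.sin w ^ 4 *
        (-Real.cos (w / m) * (120 * envelope m w ^ 7 - 64 * envelope m w ^ 5 / m ^ 2)) := by
  refine (hasDerivAt_jackson'' m w).unique ?_
  have hF := hasDerivAt_envelope hm hw
  have hF0 := envelope_ne_zero hm hw
  have hm' : (m : ℝ) ≠ 0 := by positivity
  have hs := Real.hasDerivAt_sin w
  have hk := Real.hasDerivAt_cos w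
  have h1 := ((((hs.fun_pow 2).const_mul 12).fun_mul (hk.fun_pow 2)).fun_sub
    ((hs.fun_pow 4).const_mul 4)).fun_mul (hF.fun_pow 4)
  have h2 := ((((hs.fun_pow 3).const_mul 4).fun_mul hk).const_mul 2).fun_mul
    (((hasDerivAt_cos_div hm hw).const_mul (-4)).fun_mul (hF.fun_pow 5))
  have h3 := (hs.fun_pow 4).fun_mul (((hF.fun_pow 6).const_mul 20).fun_sub
    (((hF.fun_pow 4).const_mul 16).div_const ((m : ℝ) ^ 2)))
  refine (((h1.fun_add h2).fun_add h3).congr_deriv ?_).congr_of_eventuallyEq ?_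
  · have hc := cos_div_sq hm w
    generalize envelope m w = F at *
    generalize Real.cos (w / m) = c at *
    generalize Real.sin w = s at *
    generalize Real.cos w = k at *
    simp only [Nat.cast_ofNat, Nat.add_one_sub_one]
    have e : -4 * (-1 / ((m : ℝ) ^ 2 * F)) * F ^ 5 + -4 * c * (5 * F ^ 4 * (-c * F ^ 2)) =
        20 * F ^ 6 - 16 * F ^ 4 / m ^ 2 := by
      rw [show -4 * c * (5 * F ^ 4 * (-c * F ^ 2)) = 20 * c ^ 2 * F ^ 6 by ring, hc]
      field_simp
      ring
    rw [e]
    ring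
  · filter_upwards [eventually_sin_div_ne_zero m hw] with x hx
    exact jackson''_eq hm hx

/-! ### Pointwise bounds by powers of the envelope -/

theorem abs_four_mul_sin_pow_three_mul_cos_le (w : ℝ) :
    |4 * Real.sin w ^ 3 * Real.cos w| ≤ 1.3 := by
  refine abs_le_of_sq_le_sq ?_ (by norm_num)
  have h := Real.sin_sq_add_cos_sq w
  rw [show (4 * Real.sin w ^ 3 * Real.cos w) ^ 2 =
    16 * (Real.sin w ^ 2) ^ 3 * Real.cos w ^ 2 by ring]
  rw [show Real.cos w ^ 2 = 1 - Real.sin w ^ 2 by linarith]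
  generalize Real.sin w ^ 2 = x
  -- `27/16 - 16 x³ (1 - x)` has a double zero at `x = 3/4`
  nlinarith [mul_nonneg (sq_nonneg (x - 3 / 4)) (sq_nonneg (x + 1 / 4)), sq_nonneg (x - 3 / 4)]

theorem abs_twelve_mul_sin_sq_mul_cos_sq_sub_le (w : ℝ) :
    |12 * Real.sin w ^ 2 * Real.cos w ^ 2 - 4 * Real.sin w ^ 4| ≤ 4 := by
  have h := Real.sin_sq_add_cos_sq w
  rw [show Real.sin w ^ 4 = (Real.sin w ^ 2) ^ 2 by ring,
    show Real.cos w ^ 2 = 1 - Real.sin w ^ 2 by linarith]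
  have h0 : 0 ≤ Real.sin w ^ 2 := sq_nonneg _
  have h1 : Real.sin w ^ 2 ≤ 1 := Real.sin_sq_le_one w
  generalize Real.sin w ^ 2 = x at *
  rw [abs_le]
  constructor <;> nlinarith [sq_nonneg (x - 3 / 8)]

theorem abs_third_deriv_sin_pow_four_le (w : ℝ) :
    |24 * Real.sin w * Real.cos w ^ 3 - 40 * Real.sin w ^ 3 * Real.cos w| ≤ 12 := by
  refine abs_le_of_sq_le_sq ?_ (by norm_num)
  have h := Real.sin_sq_add_cos_sq w
  rw [show (24 * Real.sin w * Real.cos w ^ 3 - 40 * Real.sin w ^ 3 * Real.cos w) ^ 2 =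
    Real.sin w ^ 2 * Real.cos w ^ 2 * (24 * Real.cos w ^ 2 - 40 * Real.sin w ^ 2) ^ 2 by ring]
  rw [show Real.cos w ^ 2 = 1 - Real.sin w ^ 2 by linarith]
  have h0 : 0 ≤ Real.sin w ^ 2 := sq_nonneg _
  have h1 : Real.sin w ^ 2 ≤ 1 := Real.sin_sq_le_one w
  generalize Real.sin w ^ 2 = x at *
  nlinarith [mul_nonneg (mul_nonneg h0 (sub_nonneg.2 h1)) (sq_nonneg (x - 7 / 8)),
    sq_nonneg (x ^ 2 - x + 1 / 10), sq_nonneg (x - 7/8), sq_nonneg (x^2 - 7/8 * x)]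

theorem inv_sq_le_envelope_sq {m : ℕ} (hm : 0 < m) {w : ℝ} (hw : Real.sin (w / m) ≠ 0) :
    1 / (m : ℝ) ^ 2 ≤ envelope m w ^ 2 := by
  rw [envelope, inv_pow, mul_pow, ← one_div]
  have h0 : (0 : ℝ) < m := by exact_mod_cast hm
  have h1 : 0 < Real.sin (w / m) ^ 2 := by positivity
  have h2 := Real.sin_sq_le_one (w / m)
  gcongr
  nlinarith [sq_nonneg (m : ℝ)]

theorem abs_twenty_mul_envelope_sub_le {m : ℕ} (hm : 0 < m) {w : ℝ}
    (hw : Real.sin (w / m) ≠ 0) :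
    |20 * envelope m w ^ 6 - 16 * envelope m w ^ 4 / m ^ 2| ≤ 20 * |envelope m w| ^ 6 := by
  have h := inv_sq_le_envelope_sq hm hw
  rw [show 20 * envelope m w ^ 6 - 16 * envelope m w ^ 4 / m ^ 2 =
    |envelope m w| ^ 4 * (20 * |envelope m w| ^ 2 - 16 * (1 / m ^ 2)) by
      rw [Even.pow_abs (by decide), sq_abs]; ring, abs_mul,
    abs_of_nonneg (by positivity : 0 ≤ |envelope m w| ^ 4)]
  rw [← sq_abs (envelope m w)] at h
  have h1 : (0 : ℝ) ≤ 1 / (m : ℝ) ^ 2 := by positivity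
  rw [abs_of_nonneg (by linarith : (0 : ℝ) ≤ 20 * |envelope m w| ^ 2 - 16 * (1 / m ^ 2))]
  calc _ ≤ |envelope m w| ^ 4 * (20 * |envelope m w| ^ 2) := by gcongr; linarith
    _ = _ := by ring

theorem abs_cos_mul_envelope_le {m : ℕ} (hm : 0 < m) {w : ℝ} (hw : Real.sin (w / m) ≠ 0) :
    |-Real.cos (w / m) * (120 * envelope m w ^ 7 - 64 * envelope m w ^ 5 / m ^ 2)| ≤
      120 * |envelope m w| ^ 7 := by
  have h := inv_sq_le_envelope_sq hm hw
  have h1 : (0 : ℝ) ≤ 1 / (m : ℝ) ^ 2 := by positivity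
  rw [show 120 * envelope m w ^ 7 - 64 * envelope m w ^ 5 / m ^ 2 =
    envelope m w ^ 5 * (120 * envelope m w ^ 2 - 64 * (1 / m ^ 2)) by ring, abs_mul, abs_mul,
    abs_neg, abs_pow, ← sq_abs (envelope m w)]
  rw [← sq_abs (envelope m w)] at h
  rw [abs_of_nonneg (by linarith : (0 : ℝ) ≤ 120 * |envelope m w| ^ 2 - 64 * (1 / m ^ 2))]
  have hc := Real.abs_cos_le_one (w / m)
  calc _ ≤ 1 * (|envelope m w| ^ 5 * (120 * |envelope m w| ^ 2)) := by
        apply mul_le_mul hc _ _ zero_le_one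
        · gcongr; linarith
        · have : (0 : ℝ) ≤ 120 * |envelope m w| ^ 2 - 64 * (1 / m ^ 2) := by linarith
          positivity
    _ = _ := by ring

theorem abs_four_mul_cos_mul_envelope_le (m : ℕ) (w : ℝ) :
    |-4 * Real.cos (w / m) * envelope m w ^ 5| ≤ 4 * |envelope m w| ^ 5 := by
  rw [abs_mul, abs_mul, abs_neg, abs_pow, abs_of_pos (by norm_num : (0 : ℝ) < 4)]
  have hc := Real.abs_cos_le_one (w / m)
  gcongr
  linarith

theorem sin_pow_four_le_one (w : ℝ) : |Real.sin w ^ 4| ≤ 1 := by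
  rw [abs_pow]
  exact pow_le_one₀ (abs_nonneg _) (Real.abs_sin_le_one w)

theorem abs_jackson_le_envelope {m : ℕ} (hm : 0 < m) {w : ℝ} (hw : Real.sin (w / m) ≠ 0) :
    |jackson m w| ≤ |envelope m w| ^ 4 := by
  rw [jackson_eq hm hw, abs_mul, abs_pow (envelope m w)]
  exact mul_le_of_le_one_left (by positivity) (sin_pow_four_le_one w)

theorem abs_jackson'_le_envelope {m : ℕ} (hm : 0 < m) {w : ℝ} (hw : Real.sin (w / m) ≠ 0) :
    |jackson' m w| ≤ 1.3 * |envelope m w| ^ 4 + 4 * |envelope m w| ^ 5 := by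
  rw [jackson'_eq hm hw]
  refine (abs_add_le _ _).trans (add_le_add ?_ ?_)
  · rw [abs_mul, abs_pow (envelope m w)]
    gcongr
    exact abs_four_mul_sin_pow_three_mul_cos_le w
  · rw [abs_mul]
    exact (mul_le_mul (sin_pow_four_le_one w) (abs_four_mul_cos_mul_envelope_le m w)
      (abs_nonneg _) zero_le_one).trans_eq (one_mul _)

theorem abs_jackson''_le_envelope {m : ℕ} (hm : 0 < m) {w : ℝ} (hw : Real.sin (w / m) ≠ 0) :
    |jackson'' m w| ≤ 4 * |envelope m w| ^ 4 + 10.4 * |envelope m w| ^ 5 +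
      20 * |envelope m w| ^ 6 := by
  rw [jackson''_eq hm hw]
  refine (abs_add_le _ _).trans (add_le_add ((abs_add_le _ _).trans (add_le_add ?_ ?_)) ?_)
  · rw [abs_mul, abs_pow (envelope m w)]
    gcongr
    exact abs_twelve_mul_sin_sq_mul_cos_sq_sub_le w
  · rw [abs_mul, abs_mul, abs_two]
    calc _ ≤ 2 * 1.3 * (4 * |envelope m w| ^ 5) := by
          gcongr
          · exact abs_four_mul_sin_pow_three_mul_cos_le w
          · exact abs_four_mul_cos_mul_envelope_le m w
      _ = _ := by ring
  · rw [abs_mul]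
    exact (mul_le_mul (sin_pow_four_le_one w) (abs_twenty_mul_envelope_sub_le hm hw)
      (abs_nonneg _) zero_le_one).trans_eq (one_mul _)

theorem abs_jackson'''_le_envelope {m : ℕ} (hm : 0 < m) {w : ℝ} (hw : Real.sin (w / m) ≠ 0) :
    |jackson''' m w| ≤ 12 * |envelope m w| ^ 4 + 48 * |envelope m w| ^ 5 +
      78 * |envelope m w| ^ 6 + 120 * |envelope m w| ^ 7 := by
  rw [jackson'''_eq hm hw]
  refine (abs_add_le _ _).trans (add_le_add ((abs_add_le _ _).trans (add_le_add
    ((abs_add_le _ _).trans (add_le_add ?_ ?_)) ?_)) ?_)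
  · rw [abs_mul, abs_pow (envelope m w)]
    gcongr
    exact abs_third_deriv_sin_pow_four_le w
  · rw [abs_mul, abs_mul, abs_of_pos (by norm_num : (0 : ℝ) < 3)]
    calc _ ≤ 3 * 4 * (4 * |envelope m w| ^ 5) := by
          gcongr
          · exact abs_twelve_mul_sin_sq_mul_cos_sq_sub_le w
          · exact abs_four_mul_cos_mul_envelope_le m w
      _ = _ := by ring
  · rw [abs_mul, abs_mul, abs_of_pos (by norm_num : (0 : ℝ) < 3)]
    calc _ ≤ 3 * 1.3 * (20 * |envelope m w| ^ 6) := by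
          gcongr
          · exact abs_four_mul_sin_pow_three_mul_cos_le w
          · exact abs_twenty_mul_envelope_sub_le hm hw
      _ = _ := by ring
  · rw [abs_mul]
    exact (mul_le_mul (sin_pow_four_le_one w) (abs_cos_mul_envelope_le hm hw)
      (abs_nonneg _) zero_le_one).trans_eq (one_mul _)

/-! ### Sums of the envelope over separated points -/

theorem one_div_pow_four_le_telescope {x p : ℝ} (hp : 0 < p) (hx : p < x) :
    1 / x ^ 4 ≤ 1 / (6 * p) * (1 / (x - p) ^ 3) - 1 / (6 * p) * (1 / (x + p) ^ 3) := by
  have h1 : 0 < x - p := sub_pos.2 hx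
  have h2 : 0 < x + p := by linarith
  have hx0 : 0 < x := by linarith
  have h3 : 0 < (x - p) * (x + p) := by positivity
  have e : 1 / (6 * p) * (1 / (x - p) ^ 3) - 1 / (6 * p) * (1 / (x + p) ^ 3) =
      (x ^ 2 + p ^ 2 / 3) / ((x - p) * (x + p)) ^ 3 := by
    field_simp
    ring
  rw [e, div_le_div_iff₀ (by positivity) (by positivity)]
  have h4 : (x - p) * (x + p) ≤ x ^ 2 := by nlinarith
  calc 1 * ((x - p) * (x + p)) ^ 3 ≤ 1 * (x ^ 2) ^ 3 := by gcongr
    _ ≤ (x ^ 2 + p ^ 2 / 3) * x ^ 4 := by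
      have : 0 ≤ p ^ 2 / 3 * x ^ 4 := by positivity
      nlinarith

theorem one_div_sq_le_telescope {x p : ℝ} (hp : 0 < p) (hx : p < x) :
    1 / x ^ 2 ≤ 1 / (2 * p) * (1 / (x - p)) - 1 / (2 * p) * (1 / (x + p)) := by
  have h1 : 0 < x - p := sub_pos.2 hx
  have h2 : 0 < x + p := by linarith
  have hx0 : 0 < x := by linarith
  have e : 1 / (2 * p) * (1 / (x - p)) - 1 / (2 * p) * (1 / (x + p)) =
      1 / ((x - p) * (x + p)) := by
    field_simp
    ring
  rw [e]
  apply one_div_le_one_div_of_le (by positivity)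
  nlinarith

/-- The terms after the first telescope through the comparison of `x⁻⁴` and `x⁻²` with their
integrals over `[x - π/2, x + π/2]`. -/
theorem sum_range_tail_le {m : ℕ} (hm : 0 < m) {a : ℝ} (ha : 0 < a) (n : ℕ) :
    ∑ k ∈ Finset.range (n + 1), (1 / (a + k * Real.pi) ^ 2 + 1 / (m : ℝ) ^ 2) ^ 2 ≤
      (1 / a ^ 2 + 1 / (m : ℝ) ^ 2) ^ 2 +
      (1 / (3 * Real.pi) * (1 / (a + Real.pi / 2) ^ 3) +
        2 / (m : ℝ) ^ 2 * (1 / Real.pi * (1 / (a + Real.pi / 2)))) -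
      (1 / (3 * Real.pi) * (1 / (a + Real.pi / 2 + n * Real.pi) ^ 3) +
        2 / (m : ℝ) ^ 2 * (1 / Real.pi * (1 / (a + Real.pi / 2 + n * Real.pi)))) +
      n * (1 / (m : ℝ) ^ 4) := by
  have hpi := Real.pi_pos
  induction n with
  | zero => simp
  | succ n ih =>
    rw [Finset.sum_range_succ]
    have hx : Real.pi / 2 < a + (n + 1 : ℕ) * Real.pi := by
      have : (0 : ℝ) ≤ n * Real.pi := by positivity
      push_cast
      linarith
    have h4 := one_div_pow_four_le_telescope (by positivity : 0 < Real.pi / 2) hx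
    have h2 := one_div_sq_le_telescope (by positivity : 0 < Real.pi / 2) hx
    rw [show 6 * (Real.pi / 2) = 3 * Real.pi by ring,
      show a + (n + 1 : ℕ) * Real.pi - Real.pi / 2 = a + Real.pi / 2 + n * Real.pi by
        push_cast; ring,
      show a + (n + 1 : ℕ) * Real.pi + Real.pi / 2 = a + Real.pi / 2 + (n + 1 : ℕ) * Real.pi by
        ring] at h4
    rw [show 2 * (Real.pi / 2) = Real.pi by ring,
      show a + (n + 1 : ℕ) * Real.pi - Real.pi / 2 = a + Real.pi / 2 + n * Real.pi by
        push_cast; ring,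
      show a + (n + 1 : ℕ) * Real.pi + Real.pi / 2 = a + Real.pi / 2 + (n + 1 : ℕ) * Real.pi by
        ring] at h2
    have hm2 : 0 ≤ 2 / (m : ℝ) ^ 2 := by positivity
    have h2' := mul_le_mul_of_nonneg_left h2 hm2
    have e : (1 / (a + (n + 1 : ℕ) * Real.pi) ^ 2 + 1 / (m : ℝ) ^ 2) ^ 2 =
        1 / (a + (n + 1 : ℕ) * Real.pi) ^ 4 +
        2 / (m : ℝ) ^ 2 * (1 / (a + (n + 1 : ℕ) * Real.pi) ^ 2) + 1 / (m : ℝ) ^ 4 := by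
      generalize a + (n + 1 : ℕ) * Real.pi = y
      rw [show (1 : ℝ) / y ^ 4 = (1 / y ^ 2) ^ 2 by rw [div_pow, ← pow_mul]; norm_num,
        show (1 : ℝ) / (m : ℝ) ^ 4 = (1 / (m : ℝ) ^ 2) ^ 2 by rw [div_pow, ← pow_mul]; norm_num,
        show (2 : ℝ) / (m : ℝ) ^ 2 = 2 * (1 / (m : ℝ) ^ 2) by ring]
      ring
    rw [e]
    have e2 : ((n + 1 : ℕ) : ℝ) * (1 / (m : ℝ) ^ 4) = n * (1 / (m : ℝ) ^ 4) + 1 / (m : ℝ) ^ 4 := by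
      push_cast; ring
    rw [e2]
    linarith

/-- A bound for the sum of the fourth powers of the envelope over `π`-separated points in
`[a, mπ/2]`: the first point contributes `a⁻⁴`, the others are compared with an integral, and
`1/2000` accounts for the periodicity when `65 ≤ m` and `5/4 ≤ a`. -/
noncomputable def tailBound (a : ℝ) : ℝ := 1 / a ^ 4 + 1 / (9.42 * (a + 1.57) ^ 3) + 1 / 2000

theorem sum_range_le_tailBound {m : ℕ} (hm : 65 ≤ m) {a : ℝ} (ha : 5 / 4 ≤ a) :
    ∑ k ∈ Finset.range m, (1 / (a + k * Real.pi) ^ 2 + 1 / (m : ℝ) ^ 2) ^ 2 ≤ tailBound a := by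
  obtain ⟨n, rfl⟩ : ∃ n, m = n + 1 := ⟨m - 1, by omega⟩
  refine (sum_range_tail_le (by omega) (by linarith) n).trans ?_
  have hpi := Real.pi_pos
  have hpi3 := Real.pi_gt_d2
  set M : ℝ := ((n + 1 : ℕ) : ℝ) with hM
  have hM65 : (65 : ℝ) ≤ M := by rw [hM]; exact_mod_cast hm
  have hnM : (n : ℝ) ≤ M := by rw [hM]; push_cast; linarith
  have ha0 : 0 < a := by linarith
  have h1 : 1 / (3 * Real.pi) * (1 / (a + Real.pi / 2) ^ 3) ≤ 1 / (9.42 * (a + 1.57) ^ 3) := by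
    rw [div_mul_div_comm, one_mul]
    gcongr <;> linarith
  have h2 : 0 ≤ 1 / (3 * Real.pi) * (1 / (a + Real.pi / 2 + n * Real.pi) ^ 3) +
        2 / M ^ 2 * (1 / Real.pi * (1 / (a + Real.pi / 2 + n * Real.pi))) := by positivity
  have hq : 1 / M ^ 2 ≤ 1 / 65 ^ 2 := by gcongr
  have hq0 : 0 ≤ 1 / M ^ 2 := by positivity
  have h3 : 1 / a ^ 2 ≤ 1 / (5 / 4) ^ 2 := by gcongr
  have h3' : 0 ≤ 1 / a ^ 2 := by positivity
  have h4 : 1 / Real.pi * (1 / (a + Real.pi / 2)) ≤ 1 / 3 * (1 / 2) := by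
    gcongr <;> linarith
  have h4' : 0 ≤ 1 / Real.pi * (1 / (a + Real.pi / 2)) := by positivity
  have h5 : (n : ℝ) * (1 / M ^ 4) ≤ 1 / 65 ^ 3 := by
    calc (n : ℝ) * (1 / M ^ 4) ≤ M * (1 / M ^ 4) := by gcongr
      _ = 1 / M ^ 3 := by field_simp
      _ ≤ 1 / 65 ^ 3 := by gcongr
  have h6 : 2 / M ^ 2 * (1 / Real.pi * (1 / (a + Real.pi / 2))) ≤
      2 * (1 / 65 ^ 2) * (1 / 3 * (1 / 2)) := by
    rw [show 2 / M ^ 2 = 2 * (1 / M ^ 2) by ring]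
    gcongr
  have h7 : (1 / a ^ 2 + 1 / M ^ 2) ^ 2 ≤
      1 / a ^ 4 + 2 * (1 / 65 ^ 2) * (1 / (5 / 4) ^ 2) + (1 / 65 ^ 2) ^ 2 := by
    have e : (1 / a ^ 2 + 1 / M ^ 2) ^ 2 =
        1 / a ^ 4 + 2 * (1 / M ^ 2) * (1 / a ^ 2) + (1 / M ^ 2) ^ 2 := by
      rw [show (1 : ℝ) / a ^ 4 = (1 / a ^ 2) ^ 2 by rw [div_pow, ← pow_mul]; norm_num]
      ring
    rw [e]
    gcongr
  rw [tailBound]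
  norm_num at h5 h6 h7 h1 h2 ⊢
  linarith

theorem envelope_sq_le {m : ℕ} (hm : 0 < m) {r : ℝ} (h0 : 0 < r) (h1 : r ≤ m * Real.pi / 2) :
    envelope m r ^ 2 ≤ 1 / r ^ 2 + 1 / (m : ℝ) ^ 2 := by
  have hm' : (0 : ℝ) < m := by exact_mod_cast hm
  set s := r / m with hs
  have hs0 : 0 < s := by positivity
  have hs1 : s ≤ Real.pi / 2 := by
    rw [hs, div_le_iff₀ hm']; linarith
  have hrs : r = m * s := by rw [hs]; field_simp
  have hsin : 0 < Real.sin s := Real.sin_pos_of_pos_of_lt_pi hs0 (by linarith [Real.pi_pos])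
  -- `s ≤ tan s`, multiplied out so as to include `s = π/2`
  have key : s * Real.cos s ≤ Real.sin s := by
    rcases hs1.lt_or_eq with h | h
    · have hc : 0 < Real.cos s := Real.cos_pos_of_mem_Ioo ⟨by linarith, h⟩
      have := Real.le_tan hs0.le h
      rwa [Real.tan_eq_sin_div_cos, le_div_iff₀ hc] at this
    · rw [h, Real.cos_pi_div_two]; simp
  have hc : 0 ≤ Real.cos s := Real.cos_nonneg_of_mem_Icc ⟨by linarith, hs1⟩
  have key2 : s ^ 2 ≤ Real.sin s ^ 2 * (1 + s ^ 2) := by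
    have := pow_le_pow_left₀ (by positivity) key 2
    nlinarith [Real.sin_sq_add_cos_sq s]
  rw [envelope, ← hs, hrs]
  have e : 1 / ((m : ℝ) * s) ^ 2 + 1 / (m : ℝ) ^ 2 = (1 + s ^ 2) / (m ^ 2 * s ^ 2) := by
    field_simp
  rw [e, inv_pow, mul_pow, ← one_div, div_le_div_iff₀ (by positivity) (by positivity)]
  nlinarith [mul_le_mul_of_nonneg_left key2 (sq_nonneg (m : ℝ))]

theorem sum_envelope_le_of_one_side {ι : Type*} {m : ℕ} (hm : 65 ≤ m) {a : ℝ} (ha : 5 / 4 ≤ a)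
    (J : Finset ι) (r : ι → ℝ) (hr : ∀ j ∈ J, a ≤ r j) (hr' : ∀ j ∈ J, r j ≤ m * Real.pi / 2)
    (hsep : ∀ i ∈ J, ∀ j ∈ J, i ≠ j → Real.pi ≤ |r i - r j|) :
    ∑ j ∈ J, |envelope m (r j)| ^ 4 ≤ tailBound a := by
  classical
  have hpi := Real.pi_pos
  have ha0 : 0 < a := by linarith
  have hm0 : 0 < m := by omega
  -- each window `[a + kπ, a + (k+1)π)` contains at most one of the points
  set k : ι → ℕ := fun j => ⌊(r j - a) / Real.pi⌋₊ with hk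
  have hk1 : ∀ j ∈ J, a + k j * Real.pi ≤ r j := by
    intro j hj
    have h0 : 0 ≤ (r j - a) / Real.pi := div_nonneg (sub_nonneg.2 (hr j hj)) hpi.le
    have := Nat.floor_le h0
    rw [le_div_iff₀ hpi] at this
    linarith
  have hk2 : ∀ j ∈ J, r j < a + (k j + 1) * Real.pi := by
    intro j hj
    have := Nat.lt_floor_add_one ((r j - a) / Real.pi)
    rw [div_lt_iff₀ hpi] at this
    linarith
  have hinj : Set.InjOn k J := by
    intro i hi j hj hij
    by_contra hne
    have h1 := hsep i hi j hj hne
    have a1 := hk1 i hi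
    have a2 := hk2 i hi
    have b1 := hk1 j hj
    have b2 := hk2 j hj
    rw [hij] at a1 a2
    have : |r i - r j| < Real.pi := abs_lt.2 ⟨by linarith, by linarith⟩
    linarith
  have hsub : J.image k ⊆ Finset.range m := by
    intro x hx
    obtain ⟨j, hj, rfl⟩ := Finset.mem_image.1 hx
    rw [Finset.mem_range]
    have h1 := hk1 j hj
    have h2 := hr' j hj
    have hm' : (0 : ℝ) < m := by exact_mod_cast hm0
    have h3 : (k j : ℝ) * Real.pi < m * Real.pi := by nlinarith
    exact_mod_cast lt_of_mul_lt_mul_right h3 hpi.le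
  calc ∑ j ∈ J, |envelope m (r j)| ^ 4
      ≤ ∑ j ∈ J, (1 / (a + k j * Real.pi) ^ 2 + 1 / (m : ℝ) ^ 2) ^ 2 := by
        refine Finset.sum_le_sum fun j hj => ?_
        have hrj : 0 < r j := lt_of_lt_of_le ha0 (hr j hj)
        have h1 := envelope_sq_le hm0 hrj (hr' j hj)
        have h2 : 1 / r j ^ 2 ≤ 1 / (a + k j * Real.pi) ^ 2 := by
          have := hk1 j hj
          gcongr
        rw [show |envelope m (r j)| ^ 4 = (envelope m (r j) ^ 2) ^ 2 by
          rw [Even.pow_abs (by decide), ← pow_mul]]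
        gcongr
        linarith
    _ = ∑ x ∈ J.image k, (1 / (a + x * Real.pi) ^ 2 + 1 / (m : ℝ) ^ 2) ^ 2 :=
        (Finset.sum_image (f := fun x : ℕ =>
          (1 / (a + x * Real.pi) ^ 2 + 1 / (m : ℝ) ^ 2) ^ 2) hinj).symm
    _ ≤ ∑ x ∈ Finset.range m, (1 / (a + x * Real.pi) ^ 2 + 1 / (m : ℝ) ^ 2) ^ 2 :=
        Finset.sum_le_sum_of_subset_of_nonneg hsub fun _ _ _ => by positivity
    _ ≤ tailBound a := sum_range_le_tailBound hm ha

theorem abs_envelope_sub_period {m : ℕ} (hm : 0 < m) (w : ℝ) (n : ℤ) :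
    |envelope m (w - n * (m * Real.pi))| = |envelope m w| := by
  have hm' : (m : ℝ) ≠ 0 := by positivity
  rw [envelope, envelope, show (w - n * (m * Real.pi)) / m = w / m - n * Real.pi by field_simp,
    Real.sin_sub_int_mul_pi, abs_inv, abs_inv, abs_mul, abs_mul, abs_mul, abs_zpow, abs_neg,
    abs_one, one_zpow, one_mul]

theorem abs_envelope_neg (m : ℕ) (w : ℝ) : |envelope m (-w)| = |envelope m w| := by
  rw [envelope, envelope, neg_div, Real.sin_neg, mul_neg, abs_inv, abs_inv, abs_neg]

theorem exists_abs_sub_period_le {m : ℕ} (hm : 0 < m) (w : ℝ) :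
    ∃ n : ℤ, |w - n * (m * Real.pi)| ≤ m * Real.pi / 2 := by
  have hP : (0 : ℝ) < m * Real.pi := by
    have := Real.pi_pos
    positivity
  refine ⟨round (w / (m * Real.pi)), ?_⟩
  have h := abs_sub_round (w / (m * Real.pi))
  rw [show w - round (w / (m * Real.pi)) * (m * Real.pi) =
    (w / (m * Real.pi) - round (w / (m * Real.pi))) * (m * Real.pi) by field_simp,
    abs_mul, abs_of_pos hP]
  nlinarith

theorem sin_div_ne_zero_of_dist {m : ℕ} (hm : 0 < m) {w : ℝ}
    (h : ∀ n : ℤ, 0 < |w - n * (m * Real.pi)|) : Real.sin (w / m) ≠ 0 := by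
  have hm' : (m : ℝ) ≠ 0 := by positivity
  intro h0
  obtain ⟨n, hn⟩ := Real.sin_eq_zero_iff.1 h0
  have := h n
  rw [show w - n * (m * Real.pi) = 0 by
    rw [eq_div_iff hm'] at hn; linarith] at this
  simp at this

theorem abs_envelope_le_of_dist {m : ℕ} (hm : 0 < m) {w a : ℝ} (ha : 0 < a)
    (h : ∀ n : ℤ, a ≤ |w - n * (m * Real.pi)|) :
    |envelope m w| ^ 2 ≤ 1 / a ^ 2 + 1 / (m : ℝ) ^ 2 := by
  obtain ⟨n, hn⟩ := exists_abs_sub_period_le hm w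
  rw [← abs_envelope_sub_period hm w n]
  have h1 := h n
  set r := w - n * (m * Real.pi)
  have h2 : |envelope m r| = |envelope m (abs r)| := by
    rcases abs_choice r with h' | h' <;> rw [h']
    rw [abs_envelope_neg]
  rw [h2, sq_abs]
  refine (envelope_sq_le hm (lt_of_lt_of_le ha h1) hn).trans ?_
  gcongr

/-- The tail estimate modulo the period: after reduction to representatives in `[-mπ/2, mπ/2]` the
points on either side of the origin are separated and at distance at least `a` from it. -/
theorem sum_envelope_le {ι : Type*} {m : ℕ} (hm : 65 ≤ m) {a : ℝ} (ha : 5 / 4 ≤ a) (t : ℝ)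
    (p : ι → ℝ) (J : Finset ι)
    (hsep : ∀ i ∈ J, ∀ j ∈ J, i ≠ j → ∀ n : ℤ, Real.pi ≤ |p i - p j - n * (m * Real.pi)|)
    (hfar : ∀ j ∈ J, ∀ n : ℤ, a ≤ |t - p j - n * (m * Real.pi)|) :
    ∑ j ∈ J, |envelope m (t - p j)| ^ 4 ≤ 2 * tailBound a := by
  have hm0 : 0 < m := by omega
  choose n hn using fun j => exists_abs_sub_period_le hm0 (t - p j)
  set r : ι → ℝ := fun j => t - p j - n j * (m * Real.pi) with hr
  have hsep' : ∀ i ∈ J, ∀ j ∈ J, i ≠ j → Real.pi ≤ |r i - r j| := by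
    intro i hi j hj hij
    have := hsep i hi j hj hij (n j - n i)
    rw [show r i - r j = -(p i - p j - ((n j - n i : ℤ) : ℝ) * (m * Real.pi)) by
      simp only [hr]; push_cast; ring, abs_neg]
    exact this
  have hr0 : ∀ j, |envelope m (t - p j)| = |envelope m (r j)| := fun j =>
    (abs_envelope_sub_period hm0 _ (n j)).symm
  simp only [hr0]
  rw [← Finset.sum_filter_add_sum_filter_not J (fun j => 0 ≤ r j), two_mul]
  refine add_le_add ?_ ?_
  · refine sum_envelope_le_of_one_side hm ha _ r ?_ ?_ ?_
    · intro j hj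
      rw [Finset.mem_filter] at hj
      have := hfar j hj.1 (n j)
      change a ≤ |r j| at this
      rwa [abs_of_nonneg hj.2] at this
    · exact fun j _ => (le_abs_self _).trans (hn j)
    · exact fun i hi j hj hij =>
        hsep' i (Finset.mem_filter.1 hi).1 j (Finset.mem_filter.1 hj).1 hij
  · simp only [← fun j => abs_envelope_neg m (r j)]
    refine sum_envelope_le_of_one_side hm ha _ (fun j => -r j) ?_ ?_ ?_
    · intro j hj
      rw [Finset.mem_filter] at hj
      have := hfar j hj.1 (n j)
      change a ≤ |r j| at this
      rwa [abs_of_neg (not_le.1 hj.2)] at this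
    · exact fun j _ => (neg_le_abs _).trans (hn j)
    · intro i hi j hj hij
      rw [show -r i - -r j = -(r i - r j) by ring, abs_neg]
      exact hsep' i (Finset.mem_filter.1 hi).1 j (Finset.mem_filter.1 hj).1 hij

/-! ### Sums of the kernel over separated points -/

section TailSums

variable {ι : Type*} {m : ℕ} {a t f T : ℝ} {p : ι → ℝ} {J : Finset ι}

/-- The points `p j` are at mutual distance at least `π` modulo `mπ`. -/
def IsSeparated (m : ℕ) (p : ι → ℝ) : Prop :=
  ∀ i j, i ≠ j → ∀ n : ℤ, Real.pi ≤ |p i - p j - n * (m * Real.pi)|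

/-- The point `t` is at distance at least `a` modulo `mπ` from the points `p j`, `j ∈ J`. -/
def IsFar (m : ℕ) (p : ι → ℝ) (J : Finset ι) (a t : ℝ) : Prop :=
  ∀ j ∈ J, ∀ n : ℤ, a ≤ |t - p j - n * (m * Real.pi)|

theorem IsFar.sin_ne_zero (hm : 65 ≤ m) (ha : 5 / 4 ≤ a) (hfar : IsFar m p J a t) {j : ι}
    (hj : j ∈ J) : Real.sin ((t - p j) / m) ≠ 0 :=
  sin_div_ne_zero_of_dist (by omega) fun n => lt_of_lt_of_le (by linarith) (hfar j hj n)

theorem IsFar.envelope_le (hm : 65 ≤ m) (ha : 5 / 4 ≤ a) (hfar : IsFar m p J a t) (hf : 0 ≤ f)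
    (hf2 : 1 / a ^ 2 + 1 / 4225 ≤ f ^ 2) {j : ι} (hj : j ∈ J) : |envelope m (t - p j)| ≤ f := by
  refine abs_le_of_sq_le_sq' ?_ hf |>.2
  refine (abs_envelope_le_of_dist (by omega) (by linarith) (hfar j hj)).trans (le_trans ?_ hf2)
  have : (65 : ℝ) ≤ m := by exact_mod_cast hm
  have : 1 / (m : ℝ) ^ 2 ≤ 1 / 65 ^ 2 := by gcongr
  norm_num at this ⊢
  linarith

/-- If `φ` is dominated by `c` times the fourth power of the envelope, then the sum of `φ` over
far separated points is at most `c` times the tail bound. -/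
theorem sum_abs_le_of_le_envelope (hm : 65 ≤ m) (ha : 5 / 4 ≤ a) (hsep : IsSeparated m p)
    (hfar : IsFar m p J a t) (hT : 2 * tailBound a ≤ T) {φ : ℝ → ℝ} {c : ℝ} (hc : 0 ≤ c)
    (h : ∀ j ∈ J, |φ (t - p j)| ≤ c * |envelope m (t - p j)| ^ 4) :
    ∑ j ∈ J, |φ (t - p j)| ≤ c * T := by
  refine (Finset.sum_le_sum h).trans ?_
  rw [← Finset.mul_sum]
  refine mul_le_mul_of_nonneg_left (le_trans ?_ hT) hc
  exact sum_envelope_le hm ha t p J (fun i _ j _ hij => hsep i j hij) hfar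

theorem sum_abs_jackson_le (hm : 65 ≤ m) (ha : 5 / 4 ≤ a) (hsep : IsSeparated m p)
    (hfar : IsFar m p J a t) (hT : 2 * tailBound a ≤ T) :
    ∑ j ∈ J, |jackson m (t - p j)| ≤ T := by
  refine (sum_abs_le_of_le_envelope hm ha hsep hfar hT zero_le_one fun j hj => ?_).trans_eq
    (one_mul T)
  rw [one_mul]
  exact abs_jackson_le_envelope (by omega) (hfar.sin_ne_zero hm ha hj)

theorem sum_abs_jackson'_le (hm : 65 ≤ m) (ha : 5 / 4 ≤ a) (hsep : IsSeparated m p)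
    (hfar : IsFar m p J a t) (hT : 2 * tailBound a ≤ T) (hf : 0 ≤ f)
    (hf2 : 1 / a ^ 2 + 1 / 4225 ≤ f ^ 2) :
    ∑ j ∈ J, |jackson' m (t - p j)| ≤ (1.3 + 4 * f) * T := by
  refine sum_abs_le_of_le_envelope hm ha hsep hfar hT (by positivity) fun j hj => ?_
  refine (abs_jackson'_le_envelope (by omega) (hfar.sin_ne_zero hm ha hj)).trans ?_
  have he := hfar.envelope_le hm ha hf hf2 hj
  generalize |envelope m (t - p j)| = e, abs_nonneg (envelope m (t - p j)) = he0 at *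
  calc 1.3 * e ^ 4 + 4 * e ^ 5 = (1.3 + 4 * e) * e ^ 4 := by ring
    _ ≤ _ := by gcongr

theorem sum_abs_jackson''_le (hm : 65 ≤ m) (ha : 5 / 4 ≤ a) (hsep : IsSeparated m p)
    (hfar : IsFar m p J a t) (hT : 2 * tailBound a ≤ T) (hf : 0 ≤ f)
    (hf2 : 1 / a ^ 2 + 1 / 4225 ≤ f ^ 2) :
    ∑ j ∈ J, |jackson'' m (t - p j)| ≤ (4 + 10.4 * f + 20 * f ^ 2) * T := by
  refine sum_abs_le_of_le_envelope hm ha hsep hfar hT (by positivity) fun j hj => ?_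
  refine (abs_jackson''_le_envelope (by omega) (hfar.sin_ne_zero hm ha hj)).trans ?_
  have he := hfar.envelope_le hm ha hf hf2 hj
  generalize |envelope m (t - p j)| = e, abs_nonneg (envelope m (t - p j)) = he0 at *
  calc _ = (4 + 10.4 * e + 20 * e ^ 2) * e ^ 4 := by ring
    _ ≤ _ := by gcongr

theorem sum_abs_jackson'''_le (hm : 65 ≤ m) (ha : 5 / 4 ≤ a) (hsep : IsSeparated m p)
    (hfar : IsFar m p J a t) (hT : 2 * tailBound a ≤ T) (hf : 0 ≤ f)
    (hf2 : 1 / a ^ 2 + 1 / 4225 ≤ f ^ 2) :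
    ∑ j ∈ J, |jackson''' m (t - p j)| ≤ (12 + 48 * f + 78 * f ^ 2 + 120 * f ^ 3) * T := by
  refine sum_abs_le_of_le_envelope hm ha hsep hfar hT (by positivity) fun j hj => ?_
  refine (abs_jackson'''_le_envelope (by omega) (hfar.sin_ne_zero hm ha hj)).trans ?_
  have he := hfar.envelope_le hm ha hf hf2 hj
  generalize |envelope m (t - p j)| = e, abs_nonneg (envelope m (t - p j)) = he0 at *
  calc _ = (12 + 48 * e + 78 * e ^ 2 + 120 * e ^ 3) * e ^ 4 := by ring
    _ ≤ _ := by gcongr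

end TailSums

/-! ### Interpolation by the kernel and its derivative -/

section Interpolation

variable {ι : Type*} {m : ℕ} {p : ι → ℝ} {α β : ι → ℂ} {J : Finset ι}

/-- The sum `∑_{j ∈ J} (α_j φ(w - p_j) + β_j ψ(w - p_j))`. -/
noncomputable def bumpSum (φ ψ : ℝ → ℝ) (p : ι → ℝ) (α β : ι → ℂ) (J : Finset ι) (w : ℝ) : ℂ :=
  ∑ j ∈ J, (α j * (φ (w - p j) : ℂ) + β j * (ψ (w - p j) : ℂ))

theorem hasDerivAt_bumpSum {φ ψ φ' ψ' : ℝ → ℝ} (hφ : ∀ x, HasDerivAt φ (φ' x) x)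
    (hψ : ∀ x, HasDerivAt ψ (ψ' x) x) (p : ι → ℝ) (α β : ι → ℂ) (J : Finset ι) (w : ℝ) :
    HasDerivAt (bumpSum φ ψ p α β J) (bumpSum φ' ψ' p α β J w) w := by
  refine HasDerivAt.fun_sum fun j _ => HasDerivAt.fun_add ?_ ?_
  · exact ((hφ (w - p j)).comp_sub_const w (p j)).ofReal_comp.const_mul (α j)
  · exact ((hψ (w - p j)).comp_sub_const w (p j)).ofReal_comp.const_mul (β j)

theorem norm_bumpSum_le {φ ψ : ℝ → ℝ} {A B S S' w : ℝ} (hA : ∀ j, ‖α j‖ ≤ A)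
    (hB : ∀ j, ‖β j‖ ≤ B) (hA0 : 0 ≤ A) (hB0 : 0 ≤ B) (hS : ∑ j ∈ J, |φ (w - p j)| ≤ S)
    (hS' : ∑ j ∈ J, |ψ (w - p j)| ≤ S') :
    ‖bumpSum φ ψ p α β J w‖ ≤ A * S + B * S' := by
  calc ‖bumpSum φ ψ p α β J w‖ ≤ ∑ j ∈ J, (A * |φ (w - p j)| + B * |ψ (w - p j)|) := by
        refine (norm_sum_le _ _).trans (Finset.sum_le_sum fun j _ => ?_)
        refine (norm_add_le _ _).trans ?_
        rw [norm_mul, norm_mul, Complex.norm_real, Complex.norm_real, Real.norm_eq_abs,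
          Real.norm_eq_abs]
        gcongr
        · exact hA j
        · exact hB j
    _ = A * ∑ j ∈ J, |φ (w - p j)| + B * ∑ j ∈ J, |ψ (w - p j)| := by
        rw [Finset.sum_add_distrib, Finset.mul_sum, Finset.mul_sum]
    _ ≤ _ := by gcongr

theorem bumpSum_univ [Fintype ι] [DecidableEq ι] (φ ψ : ℝ → ℝ) (p : ι → ℝ) (α β : ι → ℂ)
    (i : ι) (w : ℝ) :
    bumpSum φ ψ p α β Finset.univ w = α i * (φ (w - p i) : ℂ) + β i * (ψ (w - p i) : ℂ) +
      bumpSum φ ψ p α β (Finset.univ.erase i) w :=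
  (Finset.add_sum_erase _ _ (Finset.mem_univ i)).symm

/-- Moving by `u` away from a node stays at distance `π - |u|` from the others; `3.14` replaces `π`
to keep the numerical estimates rational. -/
theorem IsSeparated.isFar_erase [Fintype ι] [DecidableEq ι] (hsep : IsSeparated m p) (i : ι)
    (u : ℝ) : IsFar m p (Finset.univ.erase i) (3.14 - |u|) (p i + u) := by
  intro j hj n
  have h1 := hsep i j (Finset.ne_of_mem_erase hj).symm n
  have h2 := abs_sub_abs_le_abs_sub (p i - p j - n * (m * Real.pi)) (-u)
  rw [abs_neg, show p i - p j - n * (m * Real.pi) - -u = p i + u - p j - n * (m * Real.pi) by ring]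
    at h2
  linarith [Real.pi_gt_d2]

/-- Bounds for the coefficients of a solution of the interpolation problem; in particular the
homogeneous problem (`V = 0`) has only the trivial solution. -/
theorem coeff_bounds [Fintype ι] (hm : 65 ≤ m) (hsep : IsSeparated m p) {v : ι → ℂ} {V : ℝ}
    (hV : 0 ≤ V) (hv : ∀ i, ‖v i‖ ≤ V)
    (h0 : ∀ i, bumpSum (jackson m) (jackson' m) p α β Finset.univ (p i) = v i)
    (h1 : ∀ i, bumpSum (jackson' m) (jackson'' m) p α β Finset.univ (p i) = 0) :
    (∀ i, ‖α i‖ ≤ 1.028 * V) ∧ (∀ i, ‖β i‖ ≤ 0.0566 * V) ∧ ∀ i, ‖α i - v i‖ ≤ 0.028 * V := by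
  classical
  have hm0 : 0 < m := by omega
  -- all estimates are in terms of the sup norms `‖α‖` and `‖β‖`
  have hA : ∀ j, ‖α j‖ ≤ ‖α‖ := norm_le_pi_norm α
  have hB : ∀ j, ‖β j‖ ≤ ‖β‖ := norm_le_pi_norm β
  have hA0 := norm_nonneg α
  have hB0 := norm_nonneg β
  have hT : 2 * tailBound 3.14 ≤ 0.0237 := by norm_num [tailBound]
  have hf2 : (1 : ℝ) / 3.14 ^ 2 + 1 / 4225 ≤ 0.319 ^ 2 := by norm_num
  have hfar : ∀ i, IsFar m p (Finset.univ.erase i) 3.14 (p i) := by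
    intro i
    have := hsep.isFar_erase i 0
    rwa [abs_zero, sub_zero, add_zero] at this
  -- the diagonal entry of the system of derivatives
  have hs2 : 1.333 ≤ -jackson'' m 0 := by
    rw [jackson''_zero hm0]
    have : (65 : ℝ) ≤ m := by exact_mod_cast hm
    have : 1 / (m : ℝ) ^ 2 ≤ 1 / 65 ^ 2 := by gcongr
    norm_num at this ⊢
    linarith
  have key0 : ∀ i, ‖α i - v i‖ ≤ ‖α‖ * 0.0237 + ‖β‖ * ((1.3 + 4 * 0.319) * 0.0237) := by
    intro i
    have h := h0 i
    rw [bumpSum_univ _ _ p α β i, sub_self, jackson_zero hm0, jackson'_zero] at h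
    rw [← h, show α i - (α i * ((1 : ℝ) : ℂ) + β i * ((0 : ℝ) : ℂ) +
      bumpSum (jackson m) (jackson' m) p α β (Finset.univ.erase i) (p i)) =
      -bumpSum (jackson m) (jackson' m) p α β (Finset.univ.erase i) (p i) by push_cast; ring,
      norm_neg]
    exact norm_bumpSum_le hA hB hA0 hB0
      (sum_abs_jackson_le hm (by norm_num) hsep (hfar i) hT)
      (sum_abs_jackson'_le hm (by norm_num) hsep (hfar i) hT (by norm_num) hf2)
  have key1 : ∀ i, 1.333 * ‖β i‖ ≤ ‖α‖ * ((1.3 + 4 * 0.319) * 0.0237) +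
      ‖β‖ * ((4 + 10.4 * 0.319 + 20 * 0.319 ^ 2) * 0.0237) := by
    intro i
    have h := h1 i
    rw [bumpSum_univ _ _ p α β i, sub_self, jackson'_zero] at h
    have h' : β i * ((-jackson'' m 0 : ℝ) : ℂ) =
        bumpSum (jackson' m) (jackson'' m) p α β (Finset.univ.erase i) (p i) := by
      push_cast at h ⊢
      linear_combination -h
    calc 1.333 * ‖β i‖ ≤ ‖β i‖ * -jackson'' m 0 := by
          rw [mul_comm]; gcongr
      _ = ‖β i * ((-jackson'' m 0 : ℝ) : ℂ)‖ := by
          rw [norm_mul, Complex.norm_real, Real.norm_of_nonneg (by linarith)]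
      _ ≤ _ := by
          rw [h']
          exact norm_bumpSum_le hA hB hA0 hB0
            (sum_abs_jackson'_le hm (by norm_num) hsep (hfar i) hT (by norm_num) hf2)
            (sum_abs_jackson''_le hm (by norm_num) hsep (hfar i) hT (by norm_num) hf2)
  have hB1 : ‖β‖ ≤ 0.055 * ‖α‖ := by
    have : ‖β‖ ≤ (‖α‖ * ((1.3 + 4 * 0.319) * 0.0237) +
      ‖β‖ * ((4 + 10.4 * 0.319 + 20 * 0.319 ^ 2) * 0.0237)) / 1.333 := by
      refine (pi_norm_le_iff_of_nonneg (by positivity)).2 fun i => ?_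
      rw [le_div_iff₀ (by norm_num)]
      linarith [key1 i]
    rw [le_div_iff₀ (by norm_num)] at this
    norm_num at this ⊢
    linarith
  have hA1 : ‖α‖ ≤ 1.028 * V := by
    have : ‖α‖ ≤ V + (‖α‖ * 0.0237 + ‖β‖ * ((1.3 + 4 * 0.319) * 0.0237)) := by
      refine (pi_norm_le_iff_of_nonneg (by positivity)).2 fun i => ?_
      have h2 := norm_sub_norm_le (α i) (v i)
      linarith [key0 i, hv i]
    norm_num at this hB1 ⊢
    linarith
  refine ⟨fun i => (hA i).trans hA1, fun i => (hB i).trans ?_, fun i => (key0 i).trans ?_⟩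
  · norm_num at hB1 hA1 ⊢
    linarith
  · norm_num at hB1 hA1 ⊢
    linarith

/-- The interpolation problem with prescribed values and vanishing derivatives is solvable. -/
theorem exists_interpolation [Fintype ι] (hm : 65 ≤ m) (hsep : IsSeparated m p) (v : ι → ℂ) :
    ∃ α β : ι → ℂ, (∀ i, bumpSum (jackson m) (jackson' m) p α β Finset.univ (p i) = v i) ∧
      ∀ i, bumpSum (jackson' m) (jackson'' m) p α β Finset.univ (p i) = 0 := by
  let L : ((ι → ℂ) × (ι → ℂ)) →ₗ[ℂ] ((ι → ℂ) × (ι → ℂ)) :=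
    { toFun := fun c =>
        (fun i => bumpSum (jackson m) (jackson' m) p c.1 c.2 Finset.univ (p i),
          fun i => bumpSum (jackson' m) (jackson'' m) p c.1 c.2 Finset.univ (p i))
      map_add' := fun c d => by
        ext i <;> simp only [bumpSum, Prod.fst_add, Prod.snd_add, Pi.add_apply,
          ← Finset.sum_add_distrib] <;> exact Finset.sum_congr rfl fun j _ => by ring
      map_smul' := fun r c => by
        ext i <;> simp only [bumpSum, Prod.smul_fst, Prod.smul_snd, Pi.smul_apply, smul_eq_mul,
          RingHom.id_apply, Finset.mul_sum] <;> exact Finset.sum_congr rfl fun j _ => by ring }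
  have hinj : Function.Injective L := by
    rw [← LinearMap.ker_eq_bot, LinearMap.ker_eq_bot']
    intro c hc
    have h0 : ∀ i, bumpSum (jackson m) (jackson' m) p c.1 c.2 Finset.univ (p i) = 0 :=
      fun i => congrFun (congrArg Prod.fst hc) i
    have h1 : ∀ i, bumpSum (jackson' m) (jackson'' m) p c.1 c.2 Finset.univ (p i) = 0 :=
      fun i => congrFun (congrArg Prod.snd hc) i
    obtain ⟨hα, hβ, -⟩ := coeff_bounds hm hsep (v := 0) le_rfl (by simp) h0 h1
    ext i
    · simpa using hα i
    · simpa using hβ i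
  obtain ⟨c, hc⟩ := LinearMap.injective_iff_surjective.1 hinj (v, 0)
  exact ⟨c.1, c.2, fun i => congrFun (congrArg Prod.fst hc) i,
    fun i => congrFun (congrArg Prod.snd hc) i⟩

end Interpolation

/-! ### The interpolant has modulus less than one off the nodes -/

/-- Taylor's formula with the factor `1/2`, for complex-valued functions; the segment from `x` to
`x + u` is parametrized over `[0, 1]`, so `u` may have either sign. -/
theorem norm_taylor_remainder_le {R R' R'' : ℝ → ℂ} (hR : ∀ x, HasDerivAt R (R' x) x)
    (hR' : ∀ x, HasDerivAt R' (R'' x) x) {x u ρ : ℝ}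
    (hρ : ∀ s ∈ Set.Icc (0 : ℝ) 1, ‖R'' (x + s * u)‖ ≤ ρ) :
    ‖R (x + u) - R x - u * R' x‖ ≤ ρ * u ^ 2 / 2 := by
  have hline : ∀ s : ℝ, HasDerivAt (fun s : ℝ => x + s * u) u s := fun s => by
    simpa using ((hasDerivAt_id s).mul_const u).const_add x
  have h1 : ∀ s ∈ Set.Icc (0 : ℝ) 1, ‖R' (x + s * u) - R' x‖ ≤ ρ * |u| * s := by
    have := norm_image_sub_le_of_norm_deriv_le_segment' (f := fun s : ℝ => R' (x + s * u))
      (f' := fun s => u • R'' (x + s * u)) (C := ρ * |u|) (a := 0) (b := 1)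
      (fun s _ => ((hR' _).scomp s (hline s)).hasDerivWithinAt)
      (fun s hs => by
        rw [norm_smul, Real.norm_eq_abs, mul_comm]
        exact mul_le_mul_of_nonneg_right (hρ s (Set.Ico_subset_Icc_self hs)) (abs_nonneg u))
    intro s hs
    simpa using this s hs
  have hg : ∀ s : ℝ, HasDerivAt (fun s : ℝ => R (x + s * u) - R x - (s : ℂ) * (u * R' x))
      (u • (R' (x + s * u) - R' x)) s := by
    intro s
    have e1 := (((hR _).scomp s (hline s)).sub_const (R x)).fun_sub
      ((Complex.ofRealCLM.hasDerivAt (x := s)).mul_const (u * R' x))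
    refine e1.congr_deriv ?_
    simp only [Complex.ofRealCLM_apply, Complex.ofReal_one, Complex.real_smul]
    ring
  have hB : ∀ s : ℝ, HasDerivAt (fun s : ℝ => ρ * u ^ 2 * s ^ 2 / 2) (ρ * u ^ 2 * s) s := by
    intro s
    refine ((((hasDerivAt_id s).fun_pow 2).const_mul (ρ * u ^ 2)).div_const 2).congr_deriv ?_
    simp only [id]
    ring
  have := image_norm_le_of_norm_deriv_right_le_deriv_boundary (a := (0 : ℝ)) (b := 1)
    (f := fun s : ℝ => R (x + s * u) - R x - (s : ℂ) * (u * R' x))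
    (f' := fun s => u • (R' (x + s * u) - R' x))
    (fun s _ => (hg s).continuousAt.continuousWithinAt) (fun s _ => (hg s).hasDerivWithinAt)
    (by simp) hB
    (fun s hs => by
      rw [norm_smul, Real.norm_eq_abs]
      calc _ ≤ |u| * (ρ * |u| * s) :=
            mul_le_mul_of_nonneg_left (h1 s (Set.Ico_subset_Icc_self hs)) (abs_nonneg u)
        _ = ρ * u ^ 2 * s := by rw [← sq_abs u]; ring)
    (Set.right_mem_Icc.2 zero_le_one)
  simpa using this

theorem jackson'_neg (m : ℕ) (u : ℝ) : jackson' m (-u) = -jackson' m u := by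
  simp [jackson', neg_div]

theorem abs_jackson'_le_abs {m : ℕ} (hm : 0 < m) (u : ℝ) : |jackson' m u| ≤ 4 / 3 * |u| := by
  rcases le_total 0 u with h | h
  · rw [abs_of_nonneg h]
    exact abs_jackson'_le hm h
  · rw [abs_of_nonpos h, ← abs_neg (jackson' m u), ← jackson'_neg]
    exact abs_jackson'_le hm (by linarith)

theorem abs_jackson'_sub_le_abs {m : ℕ} (hm : 0 < m) (u : ℝ) :
    |jackson' m u - jackson'' m 0 * u| ≤ 0.8 * |u| ^ 3 := by
  rcases le_total 0 u with h | h
  · rw [abs_of_nonneg h]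
    exact abs_jackson'_sub_le hm h
  · rw [abs_of_nonpos h, ← abs_neg]
    have := abs_jackson'_sub_le hm (u := -u) (by linarith)
    rw [jackson'_neg] at this
    convert this using 2
    ring

theorem bumpSum_sub_period {ι : Type*} {m : ℕ} (hm : 0 < m) (p : ι → ℝ) (α β : ι → ℂ)
    (J : Finset ι) (t : ℝ) (n : ℤ) :
    bumpSum (jackson m) (jackson' m) p α β J (t - n * (m * Real.pi)) =
      bumpSum (jackson m) (jackson' m) p α β J t := by
  simp only [bumpSum, sub_right_comm t, jackson_sub_period hm, jackson'_sub_period hm]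

section Modulus

variable {ι : Type*} [Fintype ι] {m : ℕ} {p : ι → ℝ} {α β : ι → ℂ}

/-- Near a node the modulus drops below one because the main bump is concave there, while the
contribution of the other nodes is controlled to second order. -/
theorem norm_bumpSum_lt_one_near (hm : 65 ≤ m) (hsep : IsSeparated m p) {v : ι → ℂ}
    (hα : ∀ j, ‖α j‖ ≤ 1.028) (hβ : ∀ j, ‖β j‖ ≤ 0.0566) (hαv : ∀ j, ‖α j - v j‖ ≤ 0.028)
    (h0 : ∀ i, bumpSum (jackson m) (jackson' m) p α β Finset.univ (p i) = v i)
    (h1 : ∀ i, bumpSum (jackson' m) (jackson'' m) p α β Finset.univ (p i) = 0)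
    (i : ι) (hvi : ‖v i‖ = 1) {u : ℝ} (hu0 : u ≠ 0) (hu : |u| ≤ 0.7) :
    ‖bumpSum (jackson m) (jackson' m) p α β Finset.univ (p i + u)‖ < 1 := by
  classical
  have hm0 : 0 < m := by omega
  set J : Finset ι := Finset.univ.erase i
  set R := bumpSum (jackson m) (jackson' m) p α β J with hR
  set R' := bumpSum (jackson' m) (jackson'' m) p α β J with hR'
  set R'' := bumpSum (jackson'' m) (jackson''' m) p α β J with hR''
  have hT : 2 * tailBound 2.44 ≤ 0.0608 := by norm_num [tailBound]
  have hf2 : (1 : ℝ) / 2.44 ^ 2 + 1 / 4225 ≤ 0.4102 ^ 2 := by norm_num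
  -- the other nodes stay at distance `3.14 - 0.7 = 2.44` along the segment
  have hρ : ∀ s ∈ Set.Icc (0 : ℝ) 1, ‖R'' (p i + s * u)‖ ≤ 0.92 := by
    intro s hs
    have hfar : IsFar m p J 2.44 (p i + s * u) := by
      intro j hj n
      refine le_trans ?_ (hsep.isFar_erase i (s * u) j hj n)
      rw [abs_mul, abs_of_nonneg hs.1]
      have := mul_le_mul hs.2 hu (abs_nonneg u) zero_le_one
      linarith
    refine (norm_bumpSum_le hα hβ (by norm_num) (by norm_num)
      (sum_abs_jackson''_le hm (by norm_num) hsep hfar hT (by norm_num) hf2)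
      (sum_abs_jackson'''_le hm (by norm_num) hsep hfar hT (by norm_num) hf2)).trans ?_
    norm_num
  have htay := norm_taylor_remainder_le (hasDerivAt_bumpSum (hasDerivAt_jackson m)
    (hasDerivAt_jackson' m) p α β J) (hasDerivAt_bumpSum (hasDerivAt_jackson' m)
    (hasDerivAt_jackson'' m) p α β J) hρ
  have e0 := h0 i
  have e1 := h1 i
  rw [bumpSum_univ _ _ p α β i, sub_self, jackson_zero hm0, jackson'_zero] at e0
  rw [bumpSum_univ _ _ p α β i, sub_self, jackson'_zero] at e1
  -- subtract `u` times the derivative condition at `p i` and use the value condition there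
  have hsplit : bumpSum (jackson m) (jackson' m) p α β Finset.univ (p i + u) =
      v i * (jackson m u : ℂ) - (α i - v i) * ((1 - jackson m u : ℝ) : ℂ) +
      β i * ((jackson' m u - jackson'' m 0 * u : ℝ) : ℂ) +
      (R (p i + u) - R (p i) - u * R' (p i)) := by
    rw [bumpSum_univ _ _ p α β i, add_sub_cancel_left]
    push_cast at e0 e1 ⊢
    linear_combination e0 + (u : ℂ) * e1
  set κ := 1 - jackson m u with hκ
  have hu2 : 0 < u ^ 2 := by positivity
  have huu : u ^ 2 ≤ 0.49 := by
    rw [← sq_abs]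
    nlinarith [abs_nonneg u]
  have hκ1 : 0.5685 * u ^ 2 ≤ κ := by
    have := jackson_le hm u
    nlinarith
  have hκ2 : κ ≤ 2 / 3 * u ^ 2 := by
    have := one_sub_le_jackson hm0 u
    linarith
  have hj0 : 0 ≤ jackson m u := by
    have : jackson m u = 1 - κ := by rw [hκ]; ring
    linarith
  have hu3 : |u| ^ 3 ≤ 0.7 * u ^ 2 := by
    rw [← sq_abs, pow_succ, mul_comm]
    gcongr
  have hβi : ‖β i * ((jackson' m u - jackson'' m 0 * u : ℝ) : ℂ)‖ ≤ 0.0566 * (0.8 * |u| ^ 3) := by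
    rw [norm_mul, Complex.norm_real, Real.norm_eq_abs]
    exact mul_le_mul (hβ i) (abs_jackson'_sub_le_abs hm0 u) (abs_nonneg _) (by norm_num)
  have hαi : ‖(α i - v i) * (κ : ℂ)‖ ≤ 0.028 * κ := by
    rw [norm_mul, Complex.norm_real, Real.norm_of_nonneg (by linarith)]
    exact mul_le_mul_of_nonneg_right (hαv i) (by linarith)
  have hvJ : ‖v i * (jackson m u : ℂ)‖ = 1 - κ := by
    rw [norm_mul, hvi, one_mul, Complex.norm_real, Real.norm_of_nonneg hj0, hκ]
    ring
  rw [hsplit]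
  calc _ ≤ (1 - κ) + 0.028 * κ + 0.0566 * (0.8 * |u| ^ 3) + 0.92 * u ^ 2 / 2 := by
        refine (norm_add_le _ _).trans (add_le_add ((norm_add_le _ _).trans (add_le_add
          ((norm_sub_le _ _).trans (add_le_add hvJ.le hαi)) hβi)) htay)
    _ < 1 := by nlinarith

/-- The estimate at intermediate distance from a node: the main bump is bounded pointwise by `k`
and the other nodes are far. -/
theorem norm_bumpSum_le_mid (hm : 65 ≤ m) (hsep : IsSeparated m p)
    (hα : ∀ j, ‖α j‖ ≤ 1.028) (hβ : ∀ j, ‖β j‖ ≤ 0.0566) (i : ι) {u a f T k l : ℝ}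
    (ha : 5 / 4 ≤ a) (hu : |u| ≤ l) (hl : l + a ≤ 3.14) (hT : 2 * tailBound a ≤ T) (hf : 0 ≤ f)
    (hf2 : 1 / a ^ 2 + 1 / 4225 ≤ f ^ 2) (hk : |jackson m u| ≤ k) :
    ‖bumpSum (jackson m) (jackson' m) p α β Finset.univ (p i + u)‖ ≤
      1.028 * (k + T) + 0.0566 * (4 / 3 * l + (1.3 + 4 * f) * T) := by
  classical
  have hfar : IsFar m p (Finset.univ.erase i) a (p i + u) := fun j hj n =>
    le_trans (by linarith) (hsep.isFar_erase i u j hj n)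
  have hR := norm_bumpSum_le hα hβ (by norm_num) (by norm_num)
    (sum_abs_jackson_le hm ha hsep hfar hT) (sum_abs_jackson'_le hm ha hsep hfar hT hf hf2)
  have h1 : ‖α i * (jackson m u : ℂ)‖ ≤ 1.028 * k := by
    rw [norm_mul, Complex.norm_real, Real.norm_eq_abs]
    exact mul_le_mul (hα i) hk (abs_nonneg _) (by norm_num)
  have h2 : ‖β i * (jackson' m u : ℂ)‖ ≤ 0.0566 * (4 / 3 * l) := by
    rw [norm_mul, Complex.norm_real, Real.norm_eq_abs]
    refine mul_le_mul (hβ i) ((abs_jackson'_le_abs (by omega) u).trans ?_) (abs_nonneg _)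
      (by norm_num)
    gcongr
  rw [bumpSum_univ _ _ p α β i, add_sub_cancel_left]
  refine (norm_add_le _ _).trans (le_trans (add_le_add ((norm_add_le _ _).trans
    (add_le_add h1 h2)) hR) (le_of_eq ?_))
  ring

theorem norm_bumpSum_lt_one_far (hm : 65 ≤ m) (hsep : IsSeparated m p)
    (hα : ∀ j, ‖α j‖ ≤ 1.028) (hβ : ∀ j, ‖β j‖ ≤ 0.0566) {t : ℝ}
    (hfar : IsFar m p Finset.univ 1.3 t) :
    ‖bumpSum (jackson m) (jackson' m) p α β Finset.univ t‖ < 1 := by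
  have hT : 2 * tailBound 1.3 ≤ 0.711 := by norm_num [tailBound]
  have hf2 : (1 : ℝ) / 1.3 ^ 2 + 1 / 4225 ≤ 0.77 ^ 2 := by norm_num
  refine (norm_bumpSum_le hα hβ (by norm_num) (by norm_num)
    (sum_abs_jackson_le hm (by norm_num) hsep hfar hT)
    (sum_abs_jackson'_le hm (by norm_num) hsep hfar hT (by norm_num) hf2)).trans_lt ?_
  norm_num

/-- For `π`-separated nodes modulo `mπ` and unimodular data there is an interpolating combination
of translates of the Jackson kernel and its derivative whose modulus is less than one off the
nodes. -/
theorem exists_bumpSum_certificate (hm : 65 ≤ m) (hsep : IsSeparated m p) {v : ι → ℂ}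
    (hv : ∀ i, ‖v i‖ = 1) :
    ∃ α β : ι → ℂ, (∀ i, bumpSum (jackson m) (jackson' m) p α β Finset.univ (p i) = v i) ∧
      ∀ t : ℝ, (∀ i, ∀ n : ℤ, t - n * (m * Real.pi) ≠ p i) →
        ‖bumpSum (jackson m) (jackson' m) p α β Finset.univ t‖ < 1 := by
  obtain ⟨α, β, h0, h1⟩ := exists_interpolation hm hsep v
  obtain ⟨hα, hβ, hαv⟩ := coeff_bounds hm hsep zero_le_one (fun i => (hv i).le) h0 h1
  simp only [mul_one] at hα hβ hαv
  refine ⟨α, β, h0, fun t ht => ?_⟩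
  by_cases hfar : IsFar m p Finset.univ 1.3 t
  · exact norm_bumpSum_lt_one_far hm hsep hα hβ hfar
  simp only [IsFar, not_forall, not_le] at hfar
  obtain ⟨i, -, n, hn⟩ := hfar
  set u := t - p i - n * (m * Real.pi) with hu
  have hu0 : u ≠ 0 := fun h => ht i n (by linarith)
  rw [← bumpSum_sub_period (by omega) p α β _ t n, show t - n * (m * Real.pi) = p i + u by
    rw [hu]; ring]
  rcases le_total |u| 0.7 with h7 | h7
  · exact norm_bumpSum_lt_one_near hm hsep hα hβ hαv h0 h1 i (hv i) hu0 h7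
  have hlow := one_sub_le_jackson (m := m) (by omega) u
  have hupp := jackson_le hm u
  rcases le_total |u| 1.1 with h11 | h11
  · have hk : |jackson m u| ≤ 0.7215 := by
      have a1 : 0.49 ≤ u ^ 2 := by rw [← sq_abs]; nlinarith
      have a2 : u ^ 2 ≤ 1.21 := by rw [← sq_abs]; nlinarith [abs_nonneg u]
      rw [abs_le]
      constructor <;> nlinarith
    refine (norm_bumpSum_le_mid hm hsep hα hβ i (a := 2.04) (f := 0.491) (T := 0.121)
      (by norm_num) h11 (by norm_num) (by norm_num [tailBound]) (by norm_num) (by norm_num)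
      hk).trans_lt ?_
    norm_num
  · have hk : |jackson m u| ≤ 0.4865 := by
      have a1 : 1.21 ≤ u ^ 2 := by rw [← sq_abs]; nlinarith
      have a2 : u ^ 2 ≤ 1.69 := by rw [← sq_abs]; nlinarith [abs_nonneg u]
      rw [abs_le]
      constructor <;> nlinarith
    refine (norm_bumpSum_le_mid hm hsep hα hβ i (a := 1.84) (f := 0.544) (T := 0.182)
      (by norm_num) hn.le (by norm_num) (by norm_num [tailBound]) (by norm_num) (by norm_num)
      hk).trans_lt ?_
    norm_num

end Modulus

/-! ### The dual polynomial -/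

/-- The even part of `w ↦ bumpSum … w`, with `w = mθ/2`, is a polynomial in `cos θ`. -/
theorem exists_polynomial_eval_cos {ι : Type*} [Fintype ι] {m : ℕ} (hm : 0 < m) (p : ι → ℝ)
    (α β : ι → ℂ) :
    ∃ Q : Polynomial ℂ, Q.degree ≤ (2 * (m - 1) : ℕ) ∧ ∀ θ : ℝ,
      Q.eval ((Real.cos θ : ℝ) : ℂ) =
        (bumpSum (jackson m) (jackson' m) p α β Finset.univ (m * θ / 2) +
          bumpSum (jackson m) (jackson' m) p α β Finset.univ (-(m * θ / 2))) / 2 := by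
  have hm' : (m : ℝ) ≠ 0 := by positivity
  refine ⟨∑ j, ∑ k, Polynomial.C ((α j * (Real.cos (jacksonFreq m k * p j) : ℂ) +
    β j * (jacksonFreq m k * Real.sin (jacksonFreq m k * p j) : ℝ)) / m ^ 4) *
    Polynomial.Chebyshev.T ℂ (jacksonIntFreq m k), ?_, fun θ => ?_⟩
  · refine (Polynomial.degree_sum_le _ _).trans (Finset.sup_le fun j _ => ?_)
    refine (Polynomial.degree_sum_le _ _).trans (Finset.sup_le fun k _ => ?_)
    rw [← Polynomial.smul_eq_C_mul]
    refine (Polynomial.degree_smul_le _ _).trans ?_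
    rw [Polynomial.Chebyshev.degree_T]
    exact_mod_cast natAbs_jacksonIntFreq_le m k
  · have hT : ∀ k, (Polynomial.Chebyshev.T ℂ (jacksonIntFreq m k)).eval ((Real.cos θ : ℝ) : ℂ) =
        ((Real.cos (jacksonFreq m k * (m * θ / 2)) : ℝ) : ℂ) := by
      intro k
      rw [Complex.ofReal_cos, Polynomial.Chebyshev.T_complex_cos, Complex.ofReal_cos,
        jacksonFreq_eq]
      congr 1
      rw [show 2 * (jacksonIntFreq m k : ℝ) / m * (m * θ / 2) = jacksonIntFreq m k * θ by
        field_simp]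
      push_cast
      ring
    have hK : ∀ x w : ℝ, (jackson m (w - x) + jackson m (-w - x)) / 2 =
        ∑ k, Real.cos (jacksonFreq m k * x) * Real.cos (jacksonFreq m k * w) / m ^ 4 := by
      intro x w
      rw [jackson, jackson, ← add_div, ← Finset.sum_add_distrib, div_div, Finset.sum_div]
      refine Finset.sum_congr rfl fun k _ => ?_
      rw [mul_sub, mul_sub, mul_neg, Real.cos_sub, Real.cos_sub, Real.cos_neg, Real.sin_neg]
      field_simp
      ring
    have hK' : ∀ x w : ℝ, (jackson' m (w - x) + jackson' m (-w - x)) / 2 =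
        ∑ k, jacksonFreq m k * Real.sin (jacksonFreq m k * x) *
          Real.cos (jacksonFreq m k * w) / m ^ 4 := by
      intro x w
      rw [jackson', jackson', ← add_div, ← Finset.sum_neg_distrib, ← Finset.sum_neg_distrib,
        ← Finset.sum_add_distrib, div_div, Finset.sum_div]
      refine Finset.sum_congr rfl fun k _ => ?_
      rw [mul_sub, mul_sub, mul_neg, Real.sin_sub, Real.sin_sub, Real.cos_neg, Real.sin_neg]
      field_simp
      ring
    rw [bumpSum, bumpSum, ← Finset.sum_add_distrib, Finset.sum_div, Polynomial.eval_finsetSum]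
    refine Finset.sum_congr rfl fun j _ => ?_
    have e1 := congrArg (fun x : ℝ => (x : ℂ)) (hK (p j) (m * θ / 2))
    have e2 := congrArg (fun x : ℝ => (x : ℂ)) (hK' (p j) (m * θ / 2))
    simp only [Complex.ofReal_div, Complex.ofReal_add, Complex.ofReal_sum] at e1 e2
    rw [Polynomial.eval_finsetSum]
    have e3 : (α j * (jackson m (m * θ / 2 - p j) : ℂ) + β j * (jackson' m (m * θ / 2 - p j) : ℂ) +
        (α j * (jackson m (-(m * θ / 2) - p j) : ℂ) +
          β j * (jackson' m (-(m * θ / 2) - p j) : ℂ))) / 2 =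
        α j * (((jackson m (m * θ / 2 - p j) : ℂ) + (jackson m (-(m * θ / 2) - p j) : ℂ)) /
          ((2 : ℝ) : ℂ)) +
        β j * (((jackson' m (m * θ / 2 - p j) : ℂ) + (jackson' m (-(m * θ / 2) - p j) : ℂ)) /
          ((2 : ℝ) : ℂ)) := by
      push_cast
      ring
    rw [e3, e1, e2, Finset.mul_sum, Finset.mul_sum, ← Finset.sum_add_distrib]
    refine Finset.sum_congr rfl fun k _ => ?_
    rw [Polynomial.eval_mul, Polynomial.eval_C, hT]
    push_cast
    ring

/-- A real number whose absolute value lies in `[2δ, 2π - 2δ]` is at distance at least `2δ` from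
`2πℤ`. -/
theorem le_abs_sub_int_mul_two_pi {d δ : ℝ} (h1 : 2 * δ ≤ |d|) (h2 : |d| ≤ 2 * Real.pi - 2 * δ)
    (n : ℤ) : 2 * δ ≤ |d - n * (2 * Real.pi)| := by
  rcases eq_or_ne n 0 with rfl | hn
  · simpa using h1
  · have h3 : (1 : ℝ) ≤ |(n : ℝ)| := by exact_mod_cast Int.one_le_abs hn
    have h4 := abs_sub_abs_le_abs_sub ((n : ℝ) * (2 * Real.pi)) d
    rw [abs_sub_comm, abs_mul, abs_of_pos Real.two_pi_pos] at h4
    nlinarith [Real.pi_pos]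

theorem MinimalSeparation.arccos_mem {N : ℕ} (hN : 2 ≤ N) {X : Set I}
    (hX : MinimalSeparation N X) {x : I} (hx : x ∈ X) :
    2 * Real.pi / N ≤ Real.arccos x ∧ Real.arccos x ≤ Real.pi - 2 * Real.pi / N := by
  have hN' : (2 : ℝ) ≤ N := by exact_mod_cast hN
  have hpi := Real.pi_pos
  have h0 : 0 ≤ 2 * Real.pi / N := by positivity
  have h1 : 2 * Real.pi / N ≤ Real.pi := by
    rw [div_le_iff₀ (by linarith)]
    nlinarith
  obtain ⟨ha, hb⟩ := hX.1 x hx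
  rw [Real.cos_neg] at hb
  rw [show -Real.pi + 2 * Real.pi / N = -(Real.pi - 2 * Real.pi / N) by ring, Real.cos_neg] at ha
  constructor
  · have := Real.arccos_le_arccos hb
    rwa [Real.arccos_cos h0 h1] at this
  · have := Real.arccos_le_arccos ha
    rwa [Real.arccos_cos (by linarith) (by linarith)] at this

theorem MinimalSeparation.exists_injOn {N : ℕ} (hN : 2 ≤ N) {X : Set I}
    (hX : MinimalSeparation N X) :
    ∃ k : I → ℕ, Set.InjOn k X ∧ Set.MapsTo k X (Finset.range (N + 1)) := by
  have hN' : (2 : ℝ) ≤ N := by exact_mod_cast hN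
  have hpi := Real.pi_pos
  have hs : 0 < 4 * Real.pi / N := by positivity
  refine ⟨fun x => ⌊Real.arccos x / (4 * Real.pi / N)⌋₊, fun x hx y hy hxy => ?_, fun x hx => ?_⟩
  · by_contra hne
    have h := hX.2 x hx y hy hne
    have fx := Nat.floor_le (div_nonneg (Real.arccos_nonneg x) hs.le)
    have fx' := Nat.lt_floor_add_one (Real.arccos x / (4 * Real.pi / N))
    have fy := Nat.floor_le (div_nonneg (Real.arccos_nonneg y) hs.le)
    have fy' := Nat.lt_floor_add_one (Real.arccos y / (4 * Real.pi / N))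
    simp only at hxy
    rw [← hxy, le_div_iff₀ hs] at fy
    rw [← hxy, div_lt_iff₀ hs] at fy'
    rw [le_div_iff₀ hs] at fx
    rw [div_lt_iff₀ hs] at fx'
    have : rho x y < 4 * Real.pi / N := abs_lt.2 ⟨by linarith, by linarith⟩
    linarith
  · have h1 := Real.arccos_le_pi x
    have : Real.arccos x / (4 * Real.pi / N) ≤ N := by
      rw [div_le_iff₀ hs, mul_div_cancel₀ _ (by linarith : (N : ℝ) ≠ 0)]
      linarith
    simp only [Finset.coe_range, Set.mem_Iio]
    exact Nat.lt_succ_of_le (Nat.floor_le_of_le this)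

theorem MinimalSeparation.finite {N : ℕ} (hN : 2 ≤ N) {X : Set I}
    (hX : MinimalSeparation N X) : X.Finite := by
  obtain ⟨k, hk, hk'⟩ := hX.exists_injOn hN
  exact Set.Finite.of_injOn hk' hk (Finset.finite_toSet _)

/-- The angles of the points of `X` and their negatives, in the variable `w = mθ/2`. -/
noncomputable def angleNode (m : ℕ) (X : Set I) (i : X × Bool) : ℝ :=
  if i.2 then m * Real.arccos i.1 / 2 else -(m * Real.arccos i.1 / 2)

theorem isSeparated_angleNode {N m : ℕ} (hN : 2 ≤ N) (hm : N ≤ 2 * m) {X : Set I}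
    (hX : MinimalSeparation N X) : IsSeparated m (angleNode m X) := by
  have hN' : (2 : ℝ) ≤ N := by exact_mod_cast hN
  have hmN : (N : ℝ) ≤ 2 * m := by exact_mod_cast hm
  have hpi := Real.pi_pos
  set δ := 2 * Real.pi / N with hδ
  have hδ0 : 0 ≤ δ := by positivity
  have hscale : Real.pi ≤ (m : ℝ) / 2 * (2 * δ) := by
    rw [hδ, show (m : ℝ) / 2 * (2 * (2 * Real.pi / N)) = 2 * m * Real.pi / N by ring,
      le_div_iff₀ (by linarith)]
    nlinarith
  rintro ⟨⟨x, hx⟩, s⟩ ⟨⟨y, hy⟩, t⟩ hne n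
  obtain ⟨x1, x2⟩ := hX.arccos_mem hN hx
  obtain ⟨y1, y2⟩ := hX.arccos_mem hN hy
  have key : ∀ d : ℝ, 2 * δ ≤ |d| → |d| ≤ 2 * Real.pi - 2 * δ →
      Real.pi ≤ |(m : ℝ) / 2 * d - n * (m * Real.pi)| := by
    intro d h1 h2
    have h := le_abs_sub_int_mul_two_pi h1 h2 n
    rw [show (m : ℝ) / 2 * d - n * (m * Real.pi) = m / 2 * (d - n * (2 * Real.pi)) by ring,
      abs_mul, abs_of_nonneg (by positivity : (0 : ℝ) ≤ m / 2)]
    exact hscale.trans (by gcongr)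
  have hsame : s = t → 2 * δ ≤ |Real.arccos x - Real.arccos y| := by
    intro hst
    have hxy : x ≠ y := by
      rintro rfl
      exact hne (by rw [hst])
    have := hX.2 x hx y hy hxy
    rw [rho] at this
    rw [hδ]
    linarith [show 4 * Real.pi / N = 2 * (2 * Real.pi / N) by ring]
  have hsame' : |Real.arccos x - Real.arccos y| ≤ 2 * Real.pi - 2 * δ :=
    abs_le.2 ⟨by linarith, by linarith⟩
  have hopp : |Real.arccos x + Real.arccos y| = Real.arccos x + Real.arccos y :=
    abs_of_nonneg (by linarith)
  cases s <;> cases t <;> simp only [angleNode, Bool.false_eq_true, if_true, if_false]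
  · rw [show -((m : ℝ) * Real.arccos x / 2) - -(m * Real.arccos y / 2) =
      m / 2 * -(Real.arccos x - Real.arccos y) by ring]
    exact key _ (by rw [abs_neg]; exact hsame rfl) (by rwa [abs_neg])
  · rw [show -((m : ℝ) * Real.arccos x / 2) - m * Real.arccos y / 2 =
      m / 2 * -(Real.arccos x + Real.arccos y) by ring]
    exact key _ (by rw [abs_neg, hopp]; linarith) (by rw [abs_neg, hopp]; linarith)
  · rw [show (m : ℝ) * Real.arccos x / 2 - -(m * Real.arccos y / 2) =
      m / 2 * (Real.arccos x + Real.arccos y) by ring]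
    exact key _ (by rw [hopp]; linarith) (by rw [hopp]; linarith)
  · rw [show (m : ℝ) * Real.arccos x / 2 - m * Real.arccos y / 2 =
      m / 2 * (Real.arccos x - Real.arccos y) by ring]
    exact key _ (hsame rfl) hsame'

/-- The dual certificate: a polynomial of degree at most `N` taking prescribed unimodular values on
`X` and of modulus less than one elsewhere on `[-1, 1]`. -/
theorem exists_dual_polynomial {N : ℕ} (hN : 128 ≤ N) {X : Set I} (hX : MinimalSeparation N X)
    {v : X → ℂ} (hv : ∀ x, ‖v x‖ = 1) :
    ∃ Q : Polynomial ℂ, Q.degree ≤ N ∧ (∀ x : X, Q.eval (((x : I) : ℝ) : ℂ) = v x) ∧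
      ∀ x : I, x ∉ X → ‖Q.eval ((x : ℝ) : ℂ)‖ < 1 := by
  have : Fintype X := (hX.finite (by omega)).fintype
  -- the largest kernel of degree `2(m - 1) ≤ N`; then also `N < 2m`
  set m := N / 2 + 1 with hm
  have hm65 : 65 ≤ m := by omega
  have hm' : (m : ℝ) ≠ 0 := by positivity
  obtain ⟨α, β, h0, h1⟩ := exists_bumpSum_certificate hm65
    (isSeparated_angleNode (by omega) (by omega : N ≤ 2 * m) hX) (v := fun i => v i.1)
    (fun i => hv i.1)
  obtain ⟨Q, hQ, hQe⟩ := exists_polynomial_eval_cos (by omega : 0 < m) (angleNode m X) α β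
  have hcos : ∀ x : I, ((x : ℝ) : ℂ) = ((Real.cos (Real.arccos x) : ℝ) : ℂ) := fun x => by
    rw [Real.cos_arccos x.2.1 x.2.2]
  refine ⟨Q, hQ.trans (by exact_mod_cast (by omega : 2 * (m - 1) ≤ N)), fun x => ?_,
    fun x hx => ?_⟩
  · have e1 := h0 (x, true)
    have e2 := h0 (x, false)
    simp only [angleNode, Bool.false_eq_true, if_true, if_false] at e1 e2
    rw [hcos, hQe, e1, e2]
    ring
  · have hoff : ∀ (i : X × Bool) (n : ℤ) (θ : ℝ), Real.cos θ = x →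
        m * θ / 2 - n * (m * Real.pi) ≠ angleNode m X i := by
      rintro ⟨y, s⟩ n θ hθ h
      have hc : Real.cos θ = y := by
        rw [← Real.cos_arccos (y : I).2.1 (y : I).2.2]
        cases s <;> simp only [angleNode, Bool.false_eq_true, if_true, if_false] at h
        · have : θ - n * (2 * Real.pi) = -Real.arccos y := by
            field_simp at h
            linarith
          rw [← Real.cos_sub_int_mul_two_pi θ n, this, Real.cos_neg]
        · have : θ - n * (2 * Real.pi) = Real.arccos y := by
            field_simp at h
            linarith
          rw [← Real.cos_sub_int_mul_two_pi θ n, this]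
      have hxy : x = y := Subtype.ext (by rw [← hθ, hc])
      exact hx (hxy ▸ y.2)
    have hxc := Real.cos_arccos x.2.1 x.2.2
    have n1 := h1 (m * Real.arccos x / 2) fun i n => hoff i n _ hxc
    have n2 := h1 (-(m * Real.arccos x / 2)) fun i n => by
      have := hoff i n (-Real.arccos x) (by rw [Real.cos_neg, hxc])
      rwa [show (m : ℝ) * -Real.arccos x / 2 = -(m * Real.arccos x / 2) by ring] at this
    rw [hcos, hQe, norm_div, Complex.norm_ofNat, div_lt_one (by norm_num)]
    exact (norm_add_le _ _).trans_lt (by linarith)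

/-! ### Complex measures: the pairing with polynomials and discrete measures -/

theorem integrable_eval (g : ComplexMeasure I) [IsFiniteMeasure g.variation]
    (P : Polynomial ℂ) : Integrable (fun x : I => P.eval ((x : ℝ) : ℂ)) g.variation := by
  have hc : Continuous (fun x : I => P.eval ((x : ℝ) : ℂ)) := by fun_prop
  exact hc.integrable_of_hasCompactSupport (HasCompactSupport.of_compactSpace _)

theorem pairing_add (g : ComplexMeasure I) [IsFiniteMeasure g.variation] (P Q : Polynomial ℂ) :
    pairing g (P + Q) = pairing g P + pairing g Q := by
  simp only [pairing, Polynomial.eval_add]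
  exact VectorMeasure.integral_fun_add (integrable_eval g P) (integrable_eval g Q)

theorem pairing_smul (g : ComplexMeasure I) (c : ℂ) (P : Polynomial ℂ) :
    pairing g (c • P) = c • pairing g P := by
  simp only [pairing, Polynomial.eval_smul, VectorMeasure.integral_eq_setToFun]
  refine setToFun_smul _ (fun c s x => ?_) c _
  change (c • x) * g s = c • (x * g s)
  rw [smul_mul_assoc]

/-- Measures of finite variation pairing equally with a basis of the polynomials of degree at most
`N` pair equally with every such polynomial. -/
theorem pairing_eq_of_basis {N : ℕ} {ι : Type*} (P : Module.Basis ι ℂ (Polynomial.degreeLE ℂ N))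
    {g f : ComplexMeasure I} [IsFiniteMeasure g.variation] [IsFiniteMeasure f.variation]
    (h : ∀ k, pairing g (P k : Polynomial ℂ) = pairing f (P k : Polynomial ℂ))
    {Q : Polynomial ℂ} (hQ : Q.degree ≤ N) : pairing g Q = pairing f Q := by
  let L : ∀ (g : ComplexMeasure I) [IsFiniteMeasure g.variation],
      Polynomial.degreeLE ℂ N →ₗ[ℂ] ℂ := fun g _ =>
    { toFun := fun Q => pairing g Q
      map_add' := fun Q R => pairing_add g Q R
      map_smul' := fun c Q => pairing_smul g c Q }
  have hL : L g = L f := P.ext h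
  exact congrArg (fun l => l ⟨Q, Polynomial.mem_degreeLE.2 hQ⟩) hL

theorem enorm_pairing_le (g : ComplexMeasure I) (P : Polynomial ℂ) :
    ‖pairing g P‖ₑ ≤ ∫⁻ x : I, ‖P.eval ((x : ℝ) : ℂ)‖ₑ ∂g.variation := by
  have h := VectorMeasure.enorm_integral_le_lintegral_enorm (μ := g)
    (f := fun x : I => P.eval ((x : ℝ) : ℂ)) (B := ContinuousLinearMap.mul ℝ ℂ)
  have hB : ‖ContinuousLinearMap.mul ℝ ℂ‖ₑ = 1 := by
    rw [← ofReal_norm, ContinuousLinearMap.opNorm_mul, ENNReal.ofReal_one]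
  rw [hB, one_mul] at h
  exact h

section Discrete

variable {X : Set I} [Fintype X]

theorem isFiniteMeasure_variation_dirac (x : I) (c : ℂ) :
    IsFiniteMeasure (VectorMeasure.dirac x c).variation := by
  rw [VectorMeasure.variation_dirac]
  exact ⟨by simp⟩

theorem variation_sum_dirac_le (c : X → ℂ) :
    (∑ x : X, VectorMeasure.dirac (x : I) (c x)).variation Set.univ ≤ ∑ x, ‖c x‖ₑ := by
  refine (VectorMeasure.variation_finsetSum_le Finset.univ
    (fun x : X => VectorMeasure.dirac (x : I) (c x)) Set.univ).trans (le_of_eq ?_)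
  simp [Measure.finsetSum_apply]

theorem pairing_sum_dirac (c : X → ℂ) (P : Polynomial ℂ) :
    pairing (∑ x : X, VectorMeasure.dirac (x : I) (c x)) P =
      ∑ x : X, P.eval (((x : I) : ℝ) : ℂ) * c x := by
  rw [pairing, VectorMeasure.integral_finsetSum_vectorMeasure]
  · exact Finset.sum_congr rfl fun x _ => by
      rw [VectorMeasure.integral_dirac, ContinuousLinearMap.mul_apply']
  · intro x _
    have := isFiniteMeasure_variation_dirac x (c x)
    exact integrable_eval _ P

theorem IsDiracSum.eq_sum {f : ComplexMeasure I} {c : X → ℂ} (hf : IsDiracSum f X c) :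
    f = ∑ x : X, VectorMeasure.dirac (x : I) (c x) := by
  ext E hE
  rw [sum_apply]
  exact (hf E hE).unique (hasSum_fintype _)

theorem apply_inter_finset (g : ComplexMeasure I) {E : Set I} (hE : MeasurableSet E)
    (S : Finset I) :
    g (E ∩ S) = ∑ x ∈ S, VectorMeasure.dirac x (g {x}) E := by
  classical
  induction S using Finset.induction_on with
  | empty => simp
  | insert a S ha ih =>
    rw [Finset.sum_insert ha, ← ih, ← VectorMeasure.restrict_singleton,
      VectorMeasure.restrict_apply _ (measurableSet_singleton a) hE, Finset.coe_insert,
      Set.insert_eq, Set.inter_union_distrib_left]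
    refine VectorMeasure.of_union ?_ (hE.inter (measurableSet_singleton a))
      (hE.inter S.measurableSet)
    refine Set.disjoint_left.2 fun x hx hx' => ha ?_
    have : x = a := hx.2
    exact this ▸ hx'.2

/-- A complex measure whose variation is carried by a finite set is a sum of point masses. -/
theorem eq_sum_dirac_of_variation_compl {g : ComplexMeasure I} (h : g.variation Xᶜ = 0) :
    g = ∑ x : X, VectorMeasure.dirac (x : I) (g {(x : I)}) := by
  classical
  have hX : MeasurableSet X := (Set.toFinite X).measurableSet
  ext E hE
  have h0 : g (E \ X) = 0 := (VectorMeasure.variation_apply_eq_zero hX.compl).1 h _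
    (fun x hx => hx.2) (hE.diff hX)
  have h1 : g E = g (E ∩ X) + g (E \ X) := by
    rw [← VectorMeasure.of_union Set.disjoint_sdiff_inter.symm (hE.inter hX) (hE.diff hX),
      Set.inter_union_sdiff]
  have h2 := apply_inter_finset g hE X.toFinset
  rw [Set.coe_toFinset] at h2
  rw [h1, h0, add_zero, h2, sum_apply]
  exact (Finset.sum_subtype X.toFinset (fun x => Set.mem_toFinset)
    fun x => VectorMeasure.dirac x (g {x}) E)

end Discrete

/-- The Lagrange polynomials of `X` have degree at most `N`, because the separation bounds the
number of points. -/
theorem exists_indicator_polynomial {N : ℕ} (hN : 2 ≤ N) {X : Set I} (hX : MinimalSeparation N X)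
    (x : X) : ∃ Q : Polynomial ℂ, Q.degree ≤ N ∧ Q.eval (((x : I) : ℝ) : ℂ) = 1 ∧
      ∀ y : X, y ≠ x → Q.eval (((y : I) : ℝ) : ℂ) = 0 := by
  classical
  have : Fintype X := (hX.finite hN).fintype
  obtain ⟨k, hk, hk'⟩ := hX.exists_injOn hN
  have hcard : Fintype.card X ≤ N + 1 := by
    rw [← Set.toFinset_card, ← Finset.card_range (N + 1)]
    exact Finset.card_le_card_of_injOn k (by simpa using hk') (by simpa using hk)
  have hinj : Set.InjOn (fun y : X => (((y : I) : ℝ) : ℂ)) (Finset.univ : Finset X) :=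
    fun y _ z _ h => Subtype.ext (Subtype.ext (Complex.ofReal_injective h))
  refine ⟨Lagrange.basis Finset.univ (fun y : X => (((y : I) : ℝ) : ℂ)) x, ?_, ?_, ?_⟩
  · rw [Lagrange.degree_basis hinj (Finset.mem_univ x), Finset.card_univ]
    exact_mod_cast (by omega : Fintype.card X - 1 ≤ N)
  · exact Lagrange.eval_basis_self hinj (Finset.mem_univ x)
  · exact fun y hy => Lagrange.eval_basis_of_ne (v := fun y : X => (((y : I) : ℝ) : ℂ)) hy.symm
      (Finset.mem_univ y)

end SplineRecovery

theorem theorem1 (N : ℕ) (hN : 128 ≤ N)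
    (X : Set SplineRecovery.I) (hX : SplineRecovery.MinimalSeparation N X)
    (c : X → ℂ) (f : ComplexMeasure SplineRecovery.I)
    (hf : SplineRecovery.IsDiracSum f X c)
    (P : Module.Basis (Fin (N + 1)) ℂ (Polynomial.degreeLE ℂ N))
    (y : Fin (N + 1) → ℂ)
    (hy : ∀ k, y k = SplineRecovery.pairing f (P k : Polynomial ℂ)) :
    ∀ g : ComplexMeasure SplineRecovery.I,
      (g ∈ SplineRecovery.feasible (fun k => (P k : Polynomial ℂ)) y ∧
        IsMinOn SplineRecovery.tvNorm
          (SplineRecovery.feasible (fun k => (P k : Polynomial ℂ)) y) g) ↔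
      g = f := by
  classical
  have : Fintype X := (hX.finite (by omega)).fintype
  have hfs := hf.eq_sum
  set M := ∑ x, ‖c x‖ₑ with hM
  have hMtop : M ≠ ⊤ := by simp [hM]
  have hfM : SplineRecovery.tvNorm f ≤ M := by
    rw [hfs]
    exact SplineRecovery.variation_sum_dirac_le c
  have hffin : IsFiniteMeasure f.variation := ⟨hfM.trans_lt hMtop.lt_top⟩
  -- the certificate interpolates the conjugate phases of the coefficients
  obtain ⟨Q, hQ, hQX, hQlt⟩ := SplineRecovery.exists_dual_polynomial hN hX
    (v := fun x => if c x = 0 then 1 else (starRingEnd ℂ) (c x) / (‖c x‖ : ℂ)) (fun x => by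
      split_ifs with h
      · simp
      · simp [h])
  have hfQ : ‖SplineRecovery.pairing f Q‖ₑ = M := by
    have h1 : SplineRecovery.pairing f Q = ((∑ x, ‖c x‖ : ℝ) : ℂ) := by
      rw [hfs, SplineRecovery.pairing_sum_dirac, Complex.ofReal_sum]
      refine Finset.sum_congr rfl fun x _ => ?_
      rw [hQX]
      split_ifs with h
      · simp [h]
      · have h' : (‖c x‖ : ℂ) ≠ 0 := by simpa using h
        rw [div_mul_eq_mul_div, mul_comm, Complex.mul_conj, Complex.normSq_eq_norm_sq]
        push_cast
        field_simp
    rw [h1, ← ofReal_norm, Complex.norm_real, Real.norm_of_nonneg (by positivity),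
      ENNReal.ofReal_sum_of_nonneg fun x _ => norm_nonneg _]
    simp only [ofReal_norm, hM]
  have hQle : ∀ x : SplineRecovery.I, ‖Q.eval ((x : ℝ) : ℂ)‖ ≤ 1 := by
    intro x
    by_cases hx : x ∈ X
    · rw [hQX ⟨x, hx⟩]
      split_ifs with h
      · simp
      · simp [h]
    · exact (hQlt x hx).le
  have hpair : ∀ g ∈ SplineRecovery.feasible (fun k => (P k : Polynomial ℂ)) y,
      IsFiniteMeasure g.variation → ∀ R : Polynomial ℂ, R.degree ≤ N →
      SplineRecovery.pairing g R = SplineRecovery.pairing f R := by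
    intro g hg _ R hR
    exact SplineRecovery.pairing_eq_of_basis P (fun k => (hg k).trans (hy k)) hR
  have hle : ∀ g ∈ SplineRecovery.feasible (fun k => (P k : Polynomial ℂ)) y,
      IsFiniteMeasure g.variation →
      M ≤ ∫⁻ x : SplineRecovery.I, ‖Q.eval ((x : ℝ) : ℂ)‖ₑ ∂g.variation := by
    intro g hg hfin
    rw [← hfQ, ← hpair g hg hfin Q hQ]
    exact SplineRecovery.enorm_pairing_le g Q
  have hone : ∀ g : ComplexMeasure SplineRecovery.I,
      ∫⁻ _ : SplineRecovery.I, 1 ∂g.variation = SplineRecovery.tvNorm g := fun g => lintegral_one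
  have hQle' : ∀ x : SplineRecovery.I, ‖Q.eval ((x : ℝ) : ℂ)‖ₑ ≤ 1 := fun x => by
    rw [← ofReal_norm]
    exact ENNReal.ofReal_le_one.2 (hQle x)
  have hmin : ∀ g ∈ SplineRecovery.feasible (fun k => (P k : Polynomial ℂ)) y,
      M ≤ SplineRecovery.tvNorm g := by
    intro g hg
    rcases eq_or_ne (SplineRecovery.tvNorm g) ⊤ with h | h
    · rw [h]
      exact le_top
    · rw [← hone]
      exact (hle g hg ⟨lt_top_iff_ne_top.2 h⟩).trans (lintegral_mono hQle')
  have hfeas : f ∈ SplineRecovery.feasible (fun k => (P k : Polynomial ℂ)) y :=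
    fun k => (hy k).symm
  intro g
  constructor
  · rintro ⟨hg, hgmin⟩
    have hgM : SplineRecovery.tvNorm g ≤ M := (hgmin hfeas).trans hfM
    have hgfin : IsFiniteMeasure g.variation := ⟨hgM.trans_lt hMtop.lt_top⟩
    -- equality in the duality estimate forces `|Q| = 1` almost everywhere for `|g|`
    have hae := ae_eq_of_ae_le_of_lintegral_le (μ := g.variation)
      (f := fun x : SplineRecovery.I => ‖Q.eval ((x : ℝ) : ℂ)‖ₑ) (g := fun _ => 1)
      (Filter.Eventually.of_forall hQle')
      (((lintegral_mono hQle').trans ((hone g).le.trans hgM)).trans_lt hMtop.lt_top).ne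
      aemeasurable_const ((hone g).le.trans (hgM.trans (hle g hg hgfin)))
    have hcompl : g.variation Xᶜ = 0 := by
      refine measure_mono_null (fun x hx => ?_) (ae_iff.1 hae)
      have := hQlt x hx
      simp only [Set.mem_ofPred_eq]
      intro h
      rw [← ofReal_norm, ENNReal.ofReal_eq_one] at h
      linarith
    have hgs := SplineRecovery.eq_sum_dirac_of_variation_compl hcompl
    have hcoef : ∀ x : X, g {(x : SplineRecovery.I)} = c x := by
      intro x
      obtain ⟨R, hR, hRx, hRy⟩ := SplineRecovery.exists_indicator_polynomial (by omega) hX x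
      have hev : ∀ d : X → ℂ, ∑ z : X, R.eval (((z : SplineRecovery.I) : ℝ) : ℂ) * d z = d x := by
        intro d
        rw [Finset.sum_eq_single x (fun z _ hz => by rw [hRy z hz, zero_mul]) (by simp), hRx,
          one_mul]
      have h := hpair g hg hgfin R hR
      rw [hgs, hfs, SplineRecovery.pairing_sum_dirac, SplineRecovery.pairing_sum_dirac] at h
      rw [hev, hev] at h
      exact h
    rw [hgs, hfs]
    exact Finset.sum_congr rfl fun x _ => by rw [hcoef]
  · rintro rfl
    exact ⟨hfeas, fun h hh => hfM.trans (hmin h hh)⟩
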